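/- A homeomorphism $g : X \to Y$ between metric spaces is called quasisymmetric if there is a homeomorphism $\eta : [0,\infty) \to [0,\infty)$ such that $$\frac{d_Y(g(x),g(y))}{d_Y(g(x),g(z))} \le \eta\left(\frac{d_X(x,y)}{d_X(x,z)}\right)$$ for all $x,y,z \in X$ with $x \neq z$. The conformal dimension $\dim_C X$ of a metric space $X$ is the infimum of the Hausdorff dimensions $\dim_H Y$ over all metric spaces $Y$ for which there is a quasisymmetric homeomorphism $X \to Y$, and $X$ is called minimal for conformal dimension if $\dim_C X = \dim_H X$. For every $d \in [1,2]$ there is a continuous function $f : [0,1] \to \mathbb{R}$ such that its graph $\Gamma(f) = \{(x, f(x)) : x \in [0,1]\} \subset \mathbb{R}^2$, with the Euclidean metric, is minimal for conformal dimension and $\dim_C \Gamma(f) = d$. -/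

import Mathlib

open scoped NNReal ENNReal

/-- A homeomorphism `f : X → Y` of metric spaces is quasisymmetric if there is a homeomorphism
`η : [0, ∞) → [0, ∞)` with `d(f x, f y) / d(f x, f z) ≤ η (d(x, y) / d(x, z))` for all
`x, y, z` with `x ≠ z`. -/
def IsQuasisymmetric {X Y : Type*} [MetricSpace X] [MetricSpace Y] (f : X ≃ₜ Y) : Prop :=
  ∃ η : ℝ≥0 ≃ₜ ℝ≥0, ∀ x y z : X, x ≠ z →
    nndist (f x) (f y) / nndist (f x) (f z) ≤ η (nndist x y / nndist x z)

/-- The conformal dimension of a metric space `X`: the infimum of the Hausdorff dimensions of all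
metric spaces `Y` that are quasisymmetric images of `X`. As `Y` is in bijection with `X`, letting
`Y` range over the universe of `X` loses nothing. -/
noncomputable def conformalDim.{u} (X : Type u) [MetricSpace X] : ℝ≥0∞ :=
  sInf {s | ∃ (Y : Type u) (_ : MetricSpace Y) (f : X ≃ₜ Y),
    IsQuasisymmetric f ∧ s = dimH (Set.univ : Set Y)}

/-- A metric space is minimal for conformal dimension if its conformal dimension equals its
Hausdorff dimension. -/
def IsMinimalForConformalDim (X : Type*) [MetricSpace X] : Prop :=
  conformalDim X = dimH (Set.univ : Set X)

/-- The graph of `f : [0, 1] → ℝ` as a subset of the Euclidean plane. -/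
def euclideanGraph (f : Set.Icc (0 : ℝ) 1 → ℝ) : Set (EuclideanSpace ℝ (Fin 2)) :=
  Set.range fun x : Set.Icc (0 : ℝ) 1 => !₂[(x : ℝ), f x]

/-!
# Graphs that are minimal for conformal dimension

The zigzag function attached to odd numbers `l 0, l 1, …` has a self-affine graph: over each of the
`cols l k` columns of generation `k` it runs through one row of height `2⁻ᵏ`, and each row of that
height is traversed `mult l k` times. A quasisymmetric map distorts little the size of the graph
over a column compared to that over any pair of adjacent children whose rows fill the row of the
column. Averaging over these pairs bounds the size of the image by a sum over any cover, and
Hölder's inequality turns this into a lower bound for the Hausdorff dimension of the image.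
-/

/-! ### The zigzag function and its continuity -/

namespace ZigzagGraph

/-! Let N = `cols l k` and L = `mult l k`, so N = 2ᵏL. Over a column of width 1/N the graph has
height 2⁻ᵏ, hence L squares of side 1/N cover it up to a constant. Parameter length, viewed as a
measure on the graph, is spread evenly over the rows inside a column. If L grows like N^(d-1), up to
arbitrarily small errors in the exponent, balls of radius R have mass about R^d
(`exists_volume_near_le`, `exists_le_volume_near`), and the cover by squares gives Hausdorff
dimension at most d (`dimH_graph_le`).

For the lower bound, let h be a quasisymmetric image of the graph. Columns are much thinner than
they are tall: moving a point horizontally inside a column, into a chosen pair of adjacent children,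
costs a distance of order 1/L relative to the size of a child. Quasisymmetry makes this move
negligible in the image, so the image of the parent is hardly larger than the images of the two
children together (`width_le_pair`). Averaging over the l k pairs makes (image size)/L subadditive
up to a factor tending to 1 (`share_le_sum`). The product of these factors is subexponential while
image sizes decay geometrically, so the total loss is paid for by replacing the image size by its
power κ, for any κ < 1 (`exists_totalLoss_mul_width_le`).

A ball of radius R meets at most about R^a L columns of height about R, for a < d-1. Summing the
shares over a cover by balls of radii Rᵢ with images of size sᵢ bounds Σ sᵢ^κ Rᵢ^a from below
(`exists_width_le_sum`). Hölder's inequality with exponents b/(b-a) and b/a, where b > d, bounds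
this sum by powers of Σ sᵢ^p and Σ Rᵢ^b with p = κb/(b-a). A Vitali selection keeps Σ Rᵢ^b bounded,
so Σ sᵢ^p cannot be small, and the image has dimension at least p (`le_dimH_image`). Letting a →
d-1, b → d and κ → 1 gives p → d.

For d = 1 a segment works, since nontrivial connected spaces have dimension at least 1. -/

/-- The number of columns of generation `k`. -/
def cols (l : ℕ → ℕ) (k : ℕ) : ℕ := ∏ i ∈ Finset.range k, (2 * l i)

/-- The number of columns of generation `k` in each row of height `2⁻ᵏ`. -/
def mult (l : ℕ → ℕ) (k : ℕ) : ℕ := ∏ i ∈ Finset.range k, l i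

/-- The periodic zigzag `0, 1, 2, 1, 0, 1, 2, 1, …`. -/
def zig (i : ℕ) : ℤ := if i % 4 = 0 then 0 else if i % 4 = 2 then 2 else 1

/-- The heights, in units of `2⁻ᵏ`, of the zigzag function at the endpoints of the columns of
generation `k`. -/
def walk (l : ℕ → ℕ) : ℕ → ℕ → ℤ
  | 0, c => c
  | k + 1, c => 2 * walk l k (c / (2 * l k)) +
      (walk l k (c / (2 * l k) + 1) - walk l k (c / (2 * l k))) * zig (c % (2 * l k))

/-- The row, in units of `2⁻ᵏ`, that contains the graph over a column of generation `k`. -/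
def row (l : ℕ → ℕ) (k c : ℕ) : ℤ := min (walk l k c) (walk l k (c + 1))

/-- The zigzag function. -/
noncomputable def height (l : ℕ → ℕ) (x : ℝ) : ℝ :=
  ⨆ k, (row l k ⌊cols l k * x⌋₊ : ℝ) / 2 ^ k

variable {l : ℕ → ℕ}

lemma cols_zero : cols l 0 = 1 := by simp [cols]

lemma mult_zero : mult l 0 = 1 := by simp [mult]

lemma cols_succ (k : ℕ) : cols l (k + 1) = cols l k * (2 * l k) := by
  simp [cols, Finset.prod_range_succ]

lemma mult_succ (k : ℕ) : mult l (k + 1) = mult l k * l k := by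
  simp [mult, Finset.prod_range_succ]

lemma cols_eq (k : ℕ) : cols l k = 2 ^ k * mult l k := by
  simp [cols, mult, Finset.prod_mul_distrib]

lemma mult_pos (hl : ∀ k, Odd (l k)) (k : ℕ) : 0 < mult l k :=
  Finset.prod_pos fun i _ => (hl i).pos

lemma cols_pos (hl : ∀ k, Odd (l k)) (k : ℕ) : 0 < cols l k := by
  rw [cols_eq]; have := mult_pos hl k; positivity

lemma zig_succ (i : ℕ) : zig (i + 1) - zig i = 1 ∨ zig (i + 1) - zig i = -1 := by
  unfold zig; split_ifs <;> omega

/-- This is where oddness matters: the refined path must end on the side opposite to its start, so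
that it joins the endpoints of the coarse step. -/
lemma zig_two_mul {m : ℕ} (hm : Odd m) : zig (2 * m) = 2 := by
  obtain ⟨r, rfl⟩ := hm
  unfold zig; split_ifs <;> omega

lemma walk_succ_of_lt {k i : ℕ} (c : ℕ) (hi : i < 2 * l k) :
    walk l (k + 1) (2 * l k * c + i) =
      2 * walk l k c + (walk l k (c + 1) - walk l k c) * zig i := by
  have h1 : (2 * l k * c + i) / (2 * l k) = c := by
    rw [Nat.mul_add_div (by omega), Nat.div_eq_of_lt hi, add_zero]
  have h2 : (2 * l k * c + i) % (2 * l k) = i := by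
    rw [Nat.mul_add_mod, Nat.mod_eq_of_lt hi]
  rw [walk, h1, h2]

lemma walk_succ_mul (hl : ∀ k, Odd (l k)) (k c : ℕ) :
    walk l (k + 1) (2 * l k * c) = 2 * walk l k c := by
  have := walk_succ_of_lt (l := l) (k := k) (i := 0) c (by have := (hl k).pos; omega)
  simpa [zig] using this

lemma walk_succ (hl : ∀ k, Odd (l k)) {k i : ℕ} (c : ℕ) (hi : i ≤ 2 * l k) :
    walk l (k + 1) (2 * l k * c + i) =
      2 * walk l k c + (walk l k (c + 1) - walk l k c) * zig i := by
  rcases hi.lt_or_eq with h | rfl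
  · exact walk_succ_of_lt c h
  · rw [zig_two_mul (hl k), show 2 * l k * c + 2 * l k = 2 * l k * (c + 1) by ring,
      walk_succ_mul hl]
    ring

lemma walk_step (hl : ∀ k, Odd (l k)) (k c : ℕ) :
    walk l k (c + 1) - walk l k c = 1 ∨ walk l k (c + 1) - walk l k c = -1 := by
  induction k generalizing c with
  | zero => simp [walk]
  | succ k ih =>
    have hpos : 0 < 2 * l k := by have := (hl k).pos; omega
    have hi := Nat.mod_lt c hpos
    rw [← Nat.div_add_mod c (2 * l k), add_assoc,
      walk_succ hl _ (show c % (2 * l k) + 1 ≤ 2 * l k from hi), walk_succ hl _ hi.le]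
    rcases ih (c / (2 * l k)) with h | h <;>
      rcases zig_succ (c % (2 * l k)) with h' | h' <;> rw [h] <;> omega

/-- At even places the zigzag sits on the boundary of the parent row, alternately at the bottom and
the top, and at odd places in the middle. Hence a pair of adjacent children crosses the row once,
one child in each half. -/
lemma row_pair (hl : ∀ k, Odd (l k)) {k j : ℕ} (c : ℕ) (hj : j < l k) :
    (row l (k + 1) (2 * l k * c + 2 * j) = 2 * row l k c ∧
      row l (k + 1) (2 * l k * c + 2 * j + 1) = 2 * row l k c + 1) ∨
    (row l (k + 1) (2 * l k * c + 2 * j) = 2 * row l k c + 1 ∧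
      row l (k + 1) (2 * l k * c + 2 * j + 1) = 2 * row l k c) := by
  have h0 := walk_succ hl (k := k) (i := 2 * j) c (by omega)
  have h1 := walk_succ hl (k := k) (i := 2 * j + 1) c (by omega)
  have h2 := walk_succ hl (k := k) (i := 2 * j + 2) c (by omega)
  simp only [row]
  rw [show 2 * l k * c + 2 * j + 1 + 1 = 2 * l k * c + (2 * j + 2) by ring,
    show 2 * l k * c + 2 * j + 1 = 2 * l k * c + (2 * j + 1) by ring, h0, h1, h2]
  have z1 : zig (2 * j + 1) = 1 := by unfold zig; split_ifs <;> omega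
  have z0 : zig (2 * j) = 0 ∧ zig (2 * j + 2) = 2 ∨ zig (2 * j) = 2 ∧ zig (2 * j + 2) = 0 := by
    unfold zig; split_ifs <;> omega
  rcases walk_step hl k c with h | h <;> rcases z0 with ⟨a, b⟩ | ⟨a, b⟩ <;>
    rw [h, a, b, z1] <;> omega

lemma row_succ_div (hl : ∀ k, Odd (l k)) (k c : ℕ) :
    row l (k + 1) c = 2 * row l k (c / (2 * l k)) ∨
      row l (k + 1) c = 2 * row l k (c / (2 * l k)) + 1 := by
  have hpos : 0 < 2 * l k := by have := (hl k).pos; omega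
  have hi := Nat.mod_lt c hpos
  have h := row_pair hl (k := k) (c / (2 * l k)) (j := c % (2 * l k) / 2) (by omega)
  have h0 := Nat.div_add_mod c (2 * l k)
  rcases Nat.mod_two_eq_zero_or_one (c % (2 * l k)) with e | e
  · rw [show 2 * l k * (c / (2 * l k)) + 2 * (c % (2 * l k) / 2) = c by omega] at h
    omega
  · rw [show 2 * l k * (c / (2 * l k)) + 2 * (c % (2 * l k) / 2) + 1 = c by omega] at h
    omega

lemma walk_eq_row (hl : ∀ k, Odd (l k)) (k c : ℕ) :
    walk l k c = row l k c ∧ walk l k (c + 1) = row l k c + 1 ∨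
      walk l k c = row l k c + 1 ∧ walk l k (c + 1) = row l k c := by
  unfold row
  rcases walk_step hl k c with h | h <;> omega

lemma floor_cols_succ (hl : ∀ k, Odd (l k)) (k : ℕ) (x : ℝ) :
    ⌊cols l (k + 1) * x⌋₊ / (2 * l k) = ⌊cols l k * x⌋₊ := by
  have h : (cols l (k + 1) : ℝ) * x / ((2 * l k : ℕ) : ℝ) = cols l k * x := by
    have : ((2 * l k : ℕ) : ℝ) ≠ 0 := by
      have := (hl k).pos; positivity
    rw [cols_succ, Nat.cast_mul]; field_simp
  rw [← Nat.floor_div_natCast, h]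

/-- The rows over `x` are nested intervals, so the supremum defining `height` is their common point.
-/
lemma row_interval_succ (hl : ∀ k, Odd (l k)) (k : ℕ) (x : ℝ) :
    (row l k ⌊cols l k * x⌋₊ : ℝ) / 2 ^ k ≤ row l (k + 1) ⌊cols l (k + 1) * x⌋₊ / 2 ^ (k + 1) ∧
    ((row l (k + 1) ⌊cols l (k + 1) * x⌋₊ : ℝ) + 1) / 2 ^ (k + 1) ≤
      (row l k ⌊cols l k * x⌋₊ + 1) / 2 ^ k := by
  have h := row_succ_div hl k ⌊cols l (k + 1) * x⌋₊
  rw [floor_cols_succ hl] at h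
  have hp : (0 : ℝ) < 2 ^ k := by positivity
  rcases h with h | h <;> rw [h] <;> push_cast <;> rw [pow_succ] <;>
    constructor <;> rw [div_le_div_iff₀ (by positivity) (by positivity)] <;> nlinarith

lemma monotone_row (hl : ∀ k, Odd (l k)) (x : ℝ) :
    Monotone fun k => (row l k ⌊cols l k * x⌋₊ : ℝ) / 2 ^ k :=
  monotone_nat_of_le_succ fun k => (row_interval_succ hl k x).1

lemma antitone_row (hl : ∀ k, Odd (l k)) (x : ℝ) :
    Antitone fun k => ((row l k ⌊cols l k * x⌋₊ : ℝ) + 1) / 2 ^ k :=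
  antitone_nat_of_succ_le fun k => (row_interval_succ hl k x).2

lemma row_le_row_add_one (hl : ∀ k, Odd (l k)) (x : ℝ) (j k : ℕ) :
    (row l j ⌊cols l j * x⌋₊ : ℝ) / 2 ^ j ≤ (row l k ⌊cols l k * x⌋₊ + 1) / 2 ^ k := by
  rcases le_total j k with h | h
  · refine (monotone_row hl x h).trans ?_
    dsimp only
    gcongr; linarith
  · refine le_trans ?_ (antitone_row hl x h)
    dsimp only
    gcongr; linarith

lemma row_le_height (hl : ∀ k, Odd (l k)) (x : ℝ) (k : ℕ) :
    (row l k ⌊cols l k * x⌋₊ : ℝ) / 2 ^ k ≤ height l x :=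
  le_ciSup (f := fun k => (row l k ⌊cols l k * x⌋₊ : ℝ) / 2 ^ k)
    ⟨_, Set.forall_mem_range.2 fun j => row_le_row_add_one hl x j 0⟩ k

lemma height_le_row (hl : ∀ k, Odd (l k)) (x : ℝ) (k : ℕ) :
    height l x ≤ ((row l k ⌊cols l k * x⌋₊ : ℝ) + 1) / 2 ^ k :=
  ciSup_le fun j => row_le_row_add_one hl x j k

/-- A grid point stays a grid point of the same height in all later generations, so it lies on the
boundary of shrinking rows. This gives the height at the right end of a closed column, which the
floor assigns to the next column. -/
lemma height_eq_walk (hl : ∀ k, Odd (l k)) (k c : ℕ) :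
    height l ((c : ℝ) / cols l k) = walk l k c / 2 ^ k := by
  set x : ℝ := (c : ℝ) / cols l k with hx
  have hN : (cols l k : ℝ) ≠ 0 := by exact_mod_cast (cols_pos hl k).ne'
  have key : ∀ j, ∃ a : ℕ, (cols l (k + j) : ℝ) * x = a ∧
      (walk l (k + j) a : ℝ) / 2 ^ (k + j) = walk l k c / 2 ^ k := by
    intro j
    induction j with
    | zero => exact ⟨c, by rw [hx]; simp only [add_zero]; field_simp, rfl⟩
    | succ j ih =>
      obtain ⟨a, ha, hw⟩ := ih
      refine ⟨2 * l (k + j) * a, ?_, ?_⟩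
      · rw [← add_assoc, cols_succ]; push_cast; rw [← ha]; ring
      · rw [← add_assoc, walk_succ_mul hl, ← hw]; push_cast; rw [pow_succ]; field_simp
  have bound : ∀ j : ℕ, |height l x - walk l k c / 2 ^ k| ≤ (1 / 2) ^ j := by
    intro j
    obtain ⟨a, ha, hw⟩ := key j
    have h1 := row_le_height hl x (k + j)
    have h2 := height_le_row hl x (k + j)
    rw [ha, Nat.floor_natCast] at h1 h2
    have h3 : (row l (k + j) a : ℝ) / 2 ^ (k + j) ≤ walk l (k + j) a / 2 ^ (k + j) ∧
        (walk l (k + j) a : ℝ) / 2 ^ (k + j) ≤ (row l (k + j) a + 1) / 2 ^ (k + j) := by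
      rcases walk_eq_row hl (k + j) a with ⟨h, -⟩ | ⟨h, -⟩ <;> rw [h] <;> push_cast <;>
        constructor <;> gcongr <;> linarith
    have h4 : ((row l (k + j) a : ℝ) + 1) / 2 ^ (k + j) ≤
        row l (k + j) a / 2 ^ (k + j) + (1 / 2) ^ j := by
      rw [add_div, one_div_pow]; gcongr
      · norm_num
      · omega
    rw [← hw, abs_le]; constructor <;> linarith [h3.1, h3.2]
  have := ge_of_tendsto' (tendsto_pow_atTop_nhds_zero_of_lt_one (r := (1 / 2 : ℝ))
    (by norm_num) (by norm_num)) bound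
  exact sub_eq_zero.1 (abs_nonpos_iff.1 this)

/-- The closed column `c` of generation `k`. -/
def col (l : ℕ → ℕ) (k c : ℕ) : Set ℝ := Set.Icc ((c : ℝ) / cols l k) ((c + 1 : ℕ) / cols l k)

lemma height_mem (hl : ∀ k, Odd (l k)) {k c : ℕ} {x : ℝ} (hx : x ∈ col l k c) :
    height l x ∈ Set.Icc ((row l k c : ℝ) / 2 ^ k) ((row l k c + 1) / 2 ^ k) := by
  have hN : (0 : ℝ) < cols l k := by exact_mod_cast cols_pos hl k
  rcases hx.2.lt_or_eq with h | h
  · have : ⌊cols l k * x⌋₊ = c := by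
      have h1 := hx.1
      rw [div_le_iff₀ hN] at h1
      rw [lt_div_iff₀ hN] at h
      push_cast at h
      rw [Nat.floor_eq_iff (by nlinarith [(Nat.cast_nonneg c : (0 : ℝ) ≤ c)])]
      constructor <;> linarith
    rw [← this]
    exact ⟨row_le_height hl x k, height_le_row hl x k⟩
  · rw [h, height_eq_walk hl]
    rcases walk_eq_row hl k c with ⟨-, h⟩ | ⟨-, h⟩ <;> rw [h] <;> push_cast <;>
      constructor <;> gcongr <;> linarith

lemma mem_col_floor (hl : ∀ k, Odd (l k)) (k : ℕ) {x : ℝ} (hx : 0 ≤ x) :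
    x ∈ col l k ⌊cols l k * x⌋₊ := by
  have hN : (0 : ℝ) < cols l k := by exact_mod_cast cols_pos hl k
  refine ⟨?_, ?_⟩
  · rw [div_le_iff₀ hN, mul_comm x]; exact Nat.floor_le (by positivity)
  · rw [le_div_iff₀ hN, mul_comm x]; push_cast; exact (Nat.lt_floor_add_one _).le

lemma abs_height_sub_le (hl : ∀ k, Odd (l k)) {k c : ℕ} {x y : ℝ} (hx : x ∈ col l k c)
    (hy : y ∈ col l k c) : |height l x - height l y| ≤ 1 / 2 ^ k := by
  have h1 := height_mem hl hx
  have h2 := height_mem hl hy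
  rw [Set.mem_Icc, add_div] at h1 h2
  rw [abs_le]; constructor <;> linarith [h1.1, h1.2, h2.1, h2.2]

lemma abs_height_sub_le_of_le (hl : ∀ k, Odd (l k)) {k : ℕ} {x y : ℝ} (hx : 0 ≤ x) (hxy : x ≤ y)
    (h : y - x ≤ 1 / cols l k) : |height l x - height l y| ≤ 2 / 2 ^ k := by
  have hN : (0 : ℝ) < cols l k := by exact_mod_cast cols_pos hl k
  have h1 := mem_col_floor hl k hx
  set c := ⌊cols l k * x⌋₊
  by_cases hy : y ≤ (c + 1 : ℕ) / cols l k
  · refine (abs_height_sub_le hl h1 ⟨h1.1.trans hxy, hy⟩).trans ?_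
    gcongr; norm_num
  · push Not at hy
    have e : ((c + 1 : ℕ) : ℝ) / cols l k ≤ ((c + 1 + 1 : ℕ) : ℝ) / cols l k := by
      gcongr; omega
    have h3 : ((c + 1 : ℕ) : ℝ) / cols l k ∈ col l k c := ⟨h1.1.trans h1.2, le_rfl⟩
    have h4 : ((c + 1 : ℕ) : ℝ) / cols l k ∈ col l k (c + 1) := ⟨le_rfl, e⟩
    have h5 : y ∈ col l k (c + 1) := by
      refine ⟨hy.le, ?_⟩
      have := h1.2
      have e2 : ((c + 1 + 1 : ℕ) : ℝ) / cols l k = ((c + 1 : ℕ) : ℝ) / cols l k + 1 / cols l k := by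
        push_cast; ring
      rw [e2]; linarith
    have e3 : (2 : ℝ) / 2 ^ k = 1 / 2 ^ k + 1 / 2 ^ k := by ring
    rw [e3]
    exact (abs_sub_le _ _ _).trans (add_le_add (abs_height_sub_le hl h1 h3)
      (abs_height_sub_le hl h4 h5))

lemma continuousOn_height (hl : ∀ k, Odd (l k)) : ContinuousOn (height l) (Set.Ici 0) := by
  rw [Metric.continuousOn_iff]
  intro x hx ε hε
  obtain ⟨k, hk⟩ := exists_pow_lt_of_lt_one (show (0 : ℝ) < ε / 2 by positivity)
    (show (1 / 2 : ℝ) < 1 by norm_num)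
  have hN : (0 : ℝ) < cols l k := by exact_mod_cast cols_pos hl k
  refine ⟨1 / cols l k, by positivity, fun y hy hxy => ?_⟩
  have h2 : (2 : ℝ) / 2 ^ k < ε := by
    rw [one_div_pow] at hk
    rw [div_eq_mul_one_div]; linarith
  rw [Real.dist_eq] at hxy ⊢
  refine lt_of_le_of_lt ?_ h2
  rcases le_total x y with h | h
  · rw [abs_sub_comm]
    exact abs_height_sub_le_of_le hl hx h ((le_abs_self _).trans hxy.le)
  · rw [abs_sub_comm] at hxy
    exact abs_height_sub_le_of_le hl hy h ((le_abs_self _).trans hxy.le)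

end ZigzagGraph

/-! ### Parameter length of the pieces of the graph in small balls -/

namespace ZigzagGraph
open MeasureTheory

variable {l : ℕ → ℕ}

/-- The half-open column `c` of generation `k`. -/
def hcol (l : ℕ → ℕ) (k c : ℕ) : Set ℝ := {x | 0 ≤ x ∧ ⌊cols l k * x⌋₊ = c}

lemma hcol_eq_Ico (hl : ∀ k, Odd (l k)) (k c : ℕ) :
    hcol l k c = Set.Ico ((c : ℝ) / cols l k) ((c + 1 : ℕ) / cols l k) := by
  have hN : (0 : ℝ) < cols l k := by exact_mod_cast cols_pos hl k
  ext x
  simp only [hcol, Set.mem_ofPred_eq, Set.mem_Ico]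
  rw [div_le_iff₀ hN, lt_div_iff₀ hN, mul_comm x]
  push_cast
  constructor
  · rintro ⟨h0, h⟩
    rwa [Nat.floor_eq_iff (by positivity)] at h
  · rintro ⟨h1, h2⟩
    have h0 : 0 ≤ cols l k * x := (Nat.cast_nonneg c).trans h1
    exact ⟨nonneg_of_mul_nonneg_right h0 hN, by rw [Nat.floor_eq_iff h0]; exact ⟨h1, h2⟩⟩

lemma hcol_subset_col (hl : ∀ k, Odd (l k)) (k c : ℕ) : hcol l k c ⊆ col l k c := by
  rw [hcol_eq_Ico hl]; exact Set.Ico_subset_Icc_self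

lemma measurableSet_hcol (hl : ∀ k, Odd (l k)) (k c : ℕ) : MeasurableSet (hcol l k c) := by
  rw [hcol_eq_Ico hl]; exact measurableSet_Ico

lemma pairwise_disjoint_hcol (k : ℕ) : Pairwise (Function.onFun Disjoint (hcol l k)) := by
  intro a b hab
  rw [Function.onFun, Set.disjoint_left]
  rintro x ⟨-, h⟩ ⟨-, h'⟩
  exact hab (h.symm.trans h')

lemma volume_hcol (hl : ∀ k, Odd (l k)) (k c : ℕ) :
    volume.real (hcol l k c) = 1 / cols l k := by
  have hN : (0 : ℝ) < cols l k := by exact_mod_cast cols_pos hl k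
  rw [hcol_eq_Ico hl, Real.volume_real_Ico_of_le (by gcongr; omega)]
  push_cast; ring

lemma hcol_eq_iUnion (hl : ∀ k, Odd (l k)) (k c : ℕ) :
    hcol l k c = ⋃ i ∈ Finset.range (2 * l k), hcol l (k + 1) (2 * l k * c + i) := by
  have hpos : 0 < 2 * l k := by have := (hl k).pos; omega
  ext x
  simp only [hcol, Set.mem_ofPred_eq, Set.mem_iUnion, Finset.mem_range, exists_prop]
  rw [← floor_cols_succ hl]
  constructor
  · rintro ⟨h0, h⟩
    exact ⟨_, Nat.mod_lt _ hpos, h0, by rw [← h, Nat.div_add_mod]⟩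
  · rintro ⟨i, hi, h0, h⟩
    exact ⟨h0, by rw [h, Nat.mul_add_div hpos, Nat.div_eq_of_lt hi, add_zero]⟩

lemma volume_hcol_inter (hl : ∀ k, Odd (l k)) (k c : ℕ) {S : Set ℝ} (hS : MeasurableSet S) :
    volume.real (hcol l k c ∩ S) =
      ∑ i ∈ Finset.range (2 * l k), volume.real (hcol l (k + 1) (2 * l k * c + i) ∩ S) := by
  rw [hcol_eq_iUnion hl, Set.iUnion₂_inter, measureReal_biUnion_finset (h := ?_)]
  · intro a _ b _ hab
    exact (pairwise_disjoint_hcol (k + 1) (by simpa using hab)).mono Set.inter_subset_left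
      Set.inter_subset_left
  · exact fun i _ => (measurableSet_hcol hl _ _).inter hS
  · intro i _
    refine measure_ne_top_of_subset Set.inter_subset_left ?_
    rw [hcol_eq_Ico hl]; exact measure_Ico_lt_top.ne

/-- The points over which the graph lies in row `a` of generation `j`. -/
def rowSet (l : ℕ → ℕ) (j : ℕ) (a : ℤ) : Set ℝ := {x | row l j ⌊cols l j * x⌋₊ = a}

lemma measurableSet_rowSet (j : ℕ) (a : ℤ) : MeasurableSet (rowSet l j a) := by
  have : Measurable fun x : ℝ => row l j ⌊cols l j * x⌋₊ :=
    (measurable_from_top (f := row l j)).comp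
      (Nat.measurable_floor.comp (measurable_id.const_mul (cols l j : ℝ)))
  exact this (measurableSet_singleton a)

lemma sum_range_two_mul (f : ℕ → ℝ) (n : ℕ) :
    ∑ i ∈ Finset.range (2 * n), f i = ∑ j ∈ Finset.range n, (f (2 * j) + f (2 * j + 1)) := by
  induction n with
  | zero => simp
  | succ n ih =>
    rw [Finset.sum_range_succ, ← ih, show 2 * (n + 1) = 2 * n + 1 + 1 by ring,
      Finset.sum_range_succ, Finset.sum_range_succ, add_assoc]

/-- Equidistribution: each pair of children has exactly one member in the half row containing row
`a`, so every halving of the rows halves the length. Hence each of the 2ᵈ subrows gets the fraction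
2⁻ᵈ of the column. -/
lemma volume_hcol_inter_rowSet (hl : ∀ k, Odd (l k)) (d k c : ℕ) (a : ℤ) :
    volume.real (hcol l k c ∩ rowSet l (k + d) a) =
      if a / 2 ^ d = row l k c then (1 / (2 ^ (k + d) * mult l k) : ℝ) else 0 := by
  induction d generalizing k c with
  | zero =>
    simp only [add_zero, pow_zero, Int.ediv_one]
    split_ifs with h
    · rw [show hcol l k c ∩ rowSet l k a = hcol l k c from
        Set.inter_eq_left.2 fun x hx => by rw [rowSet, Set.mem_ofPred_eq, hx.2, h],
        volume_hcol hl, cols_eq]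
      push_cast; rfl
    · rw [show hcol l k c ∩ rowSet l k a = ∅ from Set.eq_empty_of_forall_notMem
        fun x hx => h (by have := hx.2; rw [rowSet, Set.mem_ofPred_eq, hx.1.2] at this
                          exact this.symm)]
      simp
  | succ d ih =>
    rw [volume_hcol_inter hl k c (measurableSet_rowSet _ _), show k + (d + 1) = k + 1 + d by ring]
    simp only [ih]
    rw [sum_range_two_mul]
    have hm : (mult l k : ℝ) ≠ 0 := by exact_mod_cast (mult_pos hl k).ne'
    have hlk : (l k : ℝ) ≠ 0 := by exact_mod_cast (hl k).pos.ne'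
    have hdiv : a / 2 ^ (d + 1) = a / 2 ^ d / 2 := by
      rw [pow_succ, Int.ediv_ediv_of_nonneg (by positivity)]
    trans ∑ _j ∈ Finset.range (l k), (if a / 2 ^ (d + 1) = row l k c then
      1 / (2 ^ (k + 1 + d) * (mult l (k + 1) : ℝ)) else 0)
    · refine Finset.sum_congr rfl fun j hj => ?_
      rw [hdiv]
      generalize a / 2 ^ d = b
      rw [← add_assoc]
      rcases row_pair hl c (Finset.mem_range.1 hj) with ⟨h1, h2⟩ | ⟨h1, h2⟩ <;> rw [h1, h2] <;>
        split_ifs <;> first | omega | simp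
    · rw [Finset.sum_const, Finset.card_range, mult_succ]
      split_ifs
      · push_cast; rw [nsmul_eq_mul]; field_simp
      · simp

lemma row_div (hl : ∀ k, Odd (l k)) (k d : ℕ) (x : ℝ) :
    row l (k + d) ⌊cols l (k + d) * x⌋₊ / 2 ^ d = row l k ⌊cols l k * x⌋₊ := by
  induction d with
  | zero => simp
  | succ d ih =>
    have h := row_succ_div hl (k + d) ⌊cols l (k + d + 1) * x⌋₊
    rw [floor_cols_succ hl] at h
    rw [← ih, show k + (d + 1) = k + d + 1 by ring, pow_succ',
      ← Int.ediv_ediv_of_nonneg (by norm_num)]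
    congr 1
    omega

/-- Parameters of points of the graph near the point with parameter `x₀`. -/
def near (l : ℕ → ℕ) (x₀ R : ℝ) : Set ℝ :=
  {x | 0 ≤ x ∧ |x - x₀| ≤ R ∧ |height l x - height l x₀| ≤ R}

lemma near_subset_Icc (x₀ R : ℝ) : near l x₀ R ⊆ Set.Icc (x₀ - R) (x₀ + R) := by
  rintro x ⟨-, h, -⟩
  rw [abs_le] at h
  constructor <;> linarith [h.1, h.2]

lemma volume_near_ne_top (x₀ R : ℝ) : volume (near l x₀ R) ≠ ⊤ :=
  measure_ne_top_of_subset (near_subset_Icc x₀ R) measure_Icc_lt_top.ne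

lemma exists_dyadic {R : ℝ} (h0 : 0 < R) (h1 : R ≤ 1) :
    ∃ j : ℕ, (1 : ℝ) / 2 ^ j ≤ R ∧ R < 2 / 2 ^ j := by
  have hex : ∃ j : ℕ, (1 : ℝ) / 2 ^ j ≤ R := by
    obtain ⟨j, hj⟩ := exists_pow_lt_of_lt_one h0 (show (1 / 2 : ℝ) < 1 by norm_num)
    exact ⟨j, by rw [one_div_pow] at hj; exact hj.le⟩
  classical
  refine ⟨Nat.find hex, Nat.find_spec hex, ?_⟩
  rcases Nat.eq_zero_or_pos (Nat.find hex) with h | h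
  · rw [h]; norm_num; linarith
  · have := Nat.find_min hex (m := Nat.find hex - 1) (by omega)
    push Not at this
    refine this.trans_eq ?_
    obtain ⟨m, hm⟩ : ∃ m, Nat.find hex = m + 1 := ⟨Nat.find hex - 1, by omega⟩
    rw [hm, Nat.add_sub_cancel, pow_succ]; field_simp

lemma le_of_one_div_pow_le {j k : ℕ} (h : (1 : ℝ) / 2 ^ j ≤ 1 / 2 ^ k) : k ≤ j := by
  rw [one_div_le_one_div (by positivity) (by positivity)] at h
  exact (pow_le_pow_iff_right₀ (by norm_num)).1 h

lemma one_div_cols_le (hl : ∀ k, Odd (l k)) (k : ℕ) : (1 : ℝ) / cols l k ≤ 1 / 2 ^ k := by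
  have hL : (1 : ℝ) ≤ mult l k := by exact_mod_cast mult_pos hl k
  gcongr
  rw [cols_eq]; push_cast
  nlinarith [show (0 : ℝ) < 2 ^ k by positivity]

/-- At scales below the column width, a ball meets boundedly many columns of generation k, and
boundedly many rows of height about R. -/
lemma volume_near_le (hl : ∀ k, Odd (l k)) {k : ℕ} {x₀ R : ℝ} (h0 : 0 < R)
    (hR : R ≤ 1 / cols l k) :
    volume.real (near l x₀ R) ≤ 21 * R / mult l k := by
  have hN : (0 : ℝ) < cols l k := by exact_mod_cast cols_pos hl k
  have hL : (0 : ℝ) < mult l k := by exact_mod_cast mult_pos hl k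
  have hRk := hR.trans (one_div_cols_le hl k)
  obtain ⟨j, hj1, hj2⟩ := exists_dyadic h0 (hRk.trans (by
    rw [div_le_one (by positivity)]; exact one_le_pow₀ (by norm_num)))
  obtain ⟨d, rfl⟩ := Nat.exists_eq_add_of_le (le_of_one_div_pow_le (hj1.trans hRk))
  set C : ℤ := ⌊cols l k * x₀⌋
  set Y : ℤ := ⌊2 ^ (k + d) * height l x₀⌋
  -- Abscissas differ by at most one column width and heights by less than two row heights, so 3
  -- columns and 7 rows suffice; this is the constant 21.
  set I : Finset (ℤ × ℤ) := Finset.Icc (C - 1) (C + 1) ×ˢ Finset.Icc (Y - 3) (Y + 3)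
  have hsub : near l x₀ R ⊆ ⋃ p ∈ I, (hcol l k p.1.toNat ∩ rowSet l (k + d) p.2) := by
    rintro x ⟨hx0, hx1, hx2⟩
    simp only [Set.mem_iUnion, exists_prop]
    refine ⟨(⌊cols l k * x⌋₊, row l (k + d) ⌊cols l (k + d) * x⌋₊), ?_, ⟨hx0, by simp⟩, rfl⟩
    simp only [I, Finset.mem_product, Finset.mem_Icc]
    constructor
    · rw [Int.natCast_floor_eq_floor (by positivity)]
      have h1 : |cols l k * x - cols l k * x₀| ≤ 1 := by
        rw [← mul_sub, abs_mul, abs_of_pos hN]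
        calc cols l k * |x - x₀| ≤ cols l k * (1 / cols l k) := by gcongr; exact hx1.trans hR
          _ = 1 := by field_simp
      rw [abs_le] at h1
      have a1 := Int.floor_le (cols l k * x)
      have a2 := Int.lt_floor_add_one (cols l k * x)
      have a3 := Int.floor_le (cols l k * x₀)
      have a4 := Int.lt_floor_add_one (cols l k * x₀)
      have b1 : (⌊cols l k * x⌋ : ℝ) < C + 2 := by simp only [C]; linarith
      have b2 : (C : ℝ) < ⌊cols l k * x⌋ + 2 := by simp only [C]; linarith
      norm_cast at b1 b2
      omega
    · have h1 := row_le_height hl x (k + d)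
      have h2 := height_le_row hl x (k + d)
      set r := row l (k + d) ⌊cols l (k + d) * x⌋₊
      have hp : (0 : ℝ) < 2 ^ (k + d) := by positivity
      rw [div_le_iff₀ hp] at h1
      rw [le_div_iff₀ hp] at h2
      have h3 : |2 ^ (k + d) * height l x - 2 ^ (k + d) * height l x₀| < 2 := by
        rw [← mul_sub, abs_mul, abs_of_pos hp]
        calc 2 ^ (k + d) * |height l x - height l x₀| ≤ 2 ^ (k + d) * R := by gcongr
          _ < 2 ^ (k + d) * (2 / 2 ^ (k + d)) := by gcongr
          _ = 2 := by field_simp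
      rw [abs_lt] at h3
      have a3 := Int.floor_le (2 ^ (k + d) * height l x₀)
      have a4 := Int.lt_floor_add_one (2 ^ (k + d) * height l x₀)
      have b1 : (r : ℝ) < Y + 4 := by simp only [Y]; linarith
      have b2 : (Y : ℝ) < r + 4 := by simp only [Y]; linarith
      norm_cast at b1 b2
      omega
  have hone : ∀ p ∈ I, volume.real (hcol l k p.1.toNat ∩ rowSet l (k + d) p.2) ≤
      1 / (2 ^ (k + d) * mult l k) := by
    intro p _
    rw [volume_hcol_inter_rowSet hl]
    split_ifs
    · exact le_rfl
    · positivity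
  calc volume.real (near l x₀ R)
      ≤ volume.real (⋃ p ∈ I, (hcol l k p.1.toNat ∩ rowSet l (k + d) p.2)) := by
        refine measureReal_mono hsub ?_
        refine (measure_biUnion_lt_top I.finite_toSet fun p _ => ?_).ne
        refine (measure_mono Set.inter_subset_left).trans_lt ?_
        rw [hcol_eq_Ico hl]; exact measure_Ico_lt_top
    _ ≤ ∑ p ∈ I, volume.real (hcol l k p.1.toNat ∩ rowSet l (k + d) p.2) :=
        measureReal_biUnion_finset_le _ _
    _ ≤ I.card • (1 / (2 ^ (k + d) * (mult l k : ℝ))) := Finset.sum_le_card_nsmul _ _ _ hone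
    _ = 21 * (1 / 2 ^ (k + d)) / mult l k := by
        have : I.card = 21 := by
          simp only [I, Finset.card_product, Int.card_Icc]
          rw [show C + 1 + 1 - (C - 1) = 3 by ring, show Y + 3 + 1 - (Y - 3) = 7 by ring]
          rfl
        rw [this, nsmul_eq_mul]; push_cast; field_simp
    _ ≤ 21 * R / mult l k := by gcongr

/-- The column through x₀, cut by a row of height comparable to the column width, already lies in
the ball. No bound x₀ ≤ 1 is needed because the zigzag continues over all of [0, ∞). -/
lemma le_volume_near (hl : ∀ k, Odd (l k)) {k : ℕ} {x₀ R : ℝ} (hx : 0 ≤ x₀)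
    (hR : 1 / cols l k ≤ R) :
    1 / (2 * cols l k * mult l k) ≤ volume.real (near l x₀ R) := by
  have hN : (0 : ℝ) < cols l k := by exact_mod_cast cols_pos hl k
  have hL : (0 : ℝ) < mult l k := by exact_mod_cast mult_pos hl k
  have hk := one_div_cols_le hl k
  obtain ⟨j, hj1, hj2⟩ := exists_dyadic (one_div_pos.2 hN) (hk.trans (by
    rw [div_le_one (by positivity)]; exact one_le_pow₀ (by norm_num)))
  obtain ⟨d, rfl⟩ := Nat.exists_eq_add_of_le (le_of_one_div_pow_le (hj1.trans hk))
  have hsub : hcol l k ⌊cols l k * x₀⌋₊ ∩ rowSet l (k + d) (row l (k + d) ⌊cols l (k + d) * x₀⌋₊)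
      ⊆ near l x₀ R := by
    rintro x ⟨h1, h2⟩
    refine ⟨h1.1, ?_, ?_⟩
    · have h3 := hcol_subset_col hl _ _ h1
      have h4 := mem_col_floor hl k hx
      have e : ((⌊cols l k * x₀⌋₊ + 1 : ℕ) : ℝ) / cols l k = ⌊cols l k * x₀⌋₊ / cols l k +
        1 / cols l k := by push_cast; ring
      rw [col, Set.mem_Icc, e] at h3 h4
      rw [abs_le]; constructor <;> linarith [h3.1, h3.2, h4.1, h4.2]
    · have a1 := row_le_height hl x (k + d)
      have a2 := height_le_row hl x (k + d)
      have a3 := row_le_height hl x₀ (k + d)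
      have a4 := height_le_row hl x₀ (k + d)
      rw [rowSet, Set.mem_ofPred_eq] at h2
      rw [h2] at a1 a2
      rw [add_div] at a2 a4
      rw [abs_le]; constructor <;> linarith
  refine le_trans ?_ (measureReal_mono hsub (volume_near_ne_top _ _))
  rw [volume_hcol_inter_rowSet hl, row_div hl, if_pos rfl]
  rw [div_le_div_iff₀ (by positivity) (by positivity), one_mul, one_mul]
  rw [div_lt_div_iff₀ (by positivity) (by positivity)] at hj2
  nlinarith

end ZigzagGraph

/-! ### Cuts of the tree of columns, and the quasisymmetry condition -/

namespace ZigzagGraph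
open Set

variable {l : ℕ → ℕ}

/-- `c` is a column of generation `k` one of whose strict ancestors is in `T`. -/
def HasAncestor (l : ℕ → ℕ) (T : ℕ → Finset ℕ) : ℕ → ℕ → Prop
  | 0, _ => False
  | k + 1, c => HasAncestor l T k (c / (2 * l k)) ∨ c / (2 * l k) ∈ T k

lemma hasAncestor_of_mem (hl : ∀ k, Odd (l k)) {T : ℕ → Finset ℕ} {j k : ℕ} (hjk : j < k) {x : ℝ}
    (hx : ⌊cols l j * x⌋₊ ∈ T j) : HasAncestor l T k ⌊cols l k * x⌋₊ := by
  induction k, hjk using Nat.le_induction with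
  | base => exact Or.inr (by rwa [floor_cols_succ hl])
  | succ k hk ih => exact Or.inl (by rwa [floor_cols_succ hl])

lemma sum_children {M : Type*} [AddCommMonoid M] (f : ℕ → M) (m n : ℕ) :
    ∑ c ∈ Finset.range m, ∑ i ∈ Finset.range n, f (n * c + i) =
      ∑ c ∈ Finset.range (m * n), f c := by
  induction m with
  | zero => simp
  | succ m ih =>
    rw [Finset.sum_range_succ, ih, add_mul, one_mul, Finset.sum_range_add, mul_comm n m]

open Classical in
-- A subadditive weight on a tree is bounded at the root by its sum over any family of nodes that
-- every branch meets before generation K.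
lemma le_sum_of_hasAncestor (hl : ∀ k, Odd (l k)) {u : ℕ → ℕ → ℝ} (hu : ∀ k c, 0 ≤ u k c)
    (hsub : ∀ k c, c < cols l k →
      u k c ≤ ∑ i ∈ Finset.range (2 * l k), u (k + 1) (2 * l k * c + i))
    (T : ℕ → Finset ℕ) (K : ℕ) (hK : ∀ c < cols l K, HasAncestor l T K c) :
    u 0 0 ≤ ∑ k ∈ Finset.range K, ∑ c ∈ T k, u k c := by
  -- Invariant: the root is bounded by the nodes of `T` collected so far plus the nodes of
  -- generation n without an ancestor in `T`.
  have key : ∀ n, u 0 0 ≤ (∑ k ∈ Finset.range n, ∑ c ∈ T k, u k c) +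
      ∑ c ∈ Finset.range (cols l n), if HasAncestor l T n c then 0 else u n c := by
    intro n
    induction n with
    | zero => simp [cols_zero, HasAncestor]
    | succ n ih =>
      refine ih.trans ?_
      rw [Finset.sum_range_succ, add_assoc]
      gcongr
      rw [cols_succ, ← sum_children]
      have h1 : ∑ c ∈ Finset.range (cols l n), (if c ∈ T n then u n c else 0) ≤
          ∑ c ∈ T n, u n c := by
        rw [← Finset.sum_filter]
        exact Finset.sum_le_sum_of_subset_of_nonneg (fun c hc => (Finset.mem_filter.1 hc).2)
          fun _ _ _ => hu _ _
      refine le_trans ?_ (add_le_add_left h1 _)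
      rw [← Finset.sum_add_distrib]
      refine Finset.sum_le_sum fun c hc => ?_
      have hpos : 0 < 2 * l n := by have := (hl n).pos; omega
      have hdiv : ∀ i ∈ Finset.range (2 * l n), (2 * l n * c + i) / (2 * l n) = c := by
        intro i hi
        rw [Nat.mul_add_div hpos, Nat.div_eq_of_lt (Finset.mem_range.1 hi), add_zero]
      rw [Finset.sum_congr rfl fun i hi => by rw [HasAncestor, hdiv i hi]]
      by_cases h1 : HasAncestor l T n c
      · simp only [h1, true_or, if_true, Finset.sum_const_zero, add_zero]
        split_ifs <;> simp [hu]
      · by_cases h2 : c ∈ T n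
        · simp [h1, h2]
        · simpa [h1, h2] using hsub n c (Finset.mem_range.1 hc)
  refine (key K).trans_eq ?_
  rw [Finset.sum_eq_zero (s := Finset.range (cols l K)), add_zero]
  intro c hc
  rw [if_pos (hK c (Finset.mem_range.1 hc))]

/-- `G` parametrizes the graph of the zigzag function, up to a bounded change of the metric. -/
structure IsGraphMap {X : Type*} [PseudoMetricSpace X] (l : ℕ → ℕ) (G : ℝ → X) : Prop where
  abs_sub_le : ∀ x y, |x - y| ≤ dist (G x) (G y)
  abs_height_le : ∀ x y, |height l x - height l y| ≤ dist (G x) (G y)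
  dist_le : ∀ x y, dist (G x) (G y) ≤ |x - y| + |height l x - height l y|

/-- The quasisymmetry condition for the map that sends `G x` to `h x`, for `x ∈ [0, 1]`. -/
structure IsQSParam {X Y : Type*} [PseudoMetricSpace X] [PseudoMetricSpace Y] (G : ℝ → X)
    (h : ℝ → Y) (η : ℝ → ℝ) : Prop where
  nonneg : ∀ t, 0 ≤ t → 0 ≤ η t
  mono : MonotoneOn η (Ici 0)
  tendsto : Filter.Tendsto η (nhdsWithin 0 (Ici 0)) (nhds 0)
  cont : ContinuousOn h (Icc 0 1)
  dist_le : ∀ x ∈ Icc (0 : ℝ) 1, ∀ y ∈ Icc (0 : ℝ) 1, ∀ z ∈ Icc (0 : ℝ) 1, x ≠ z →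
    dist (h x) (h y) ≤ η (dist (G x) (G y) / dist (G x) (G z)) * dist (h x) (h z)

variable {X Y : Type*} [PseudoMetricSpace X] [PseudoMetricSpace Y] {G : ℝ → X} {h : ℝ → Y}
  {η : ℝ → ℝ}

/-- The size of the image of a column. -/
noncomputable def width (l : ℕ → ℕ) (h : ℝ → Y) (k c : ℕ) : ℝ := Metric.diam (h '' col l k c)

lemma width_nonneg (k c : ℕ) : 0 ≤ width l h k c := Metric.diam_nonneg

lemma col_subset_Icc (hl : ∀ k, Odd (l k)) {k c : ℕ} (hc : c < cols l k) :
    col l k c ⊆ Icc 0 1 := by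
  have hN : (0 : ℝ) < cols l k := by exact_mod_cast cols_pos hl k
  refine Icc_subset_Icc (by positivity) ?_
  rw [div_le_one hN]; exact_mod_cast hc

lemma left_mem_col (k c : ℕ) : (c : ℝ) / cols l k ∈ col l k c :=
  ⟨le_rfl, by gcongr; omega⟩

lemma right_mem_col (k c : ℕ) : ((c + 1 : ℕ) : ℝ) / cols l k ∈ col l k c :=
  ⟨by gcongr; omega, le_rfl⟩

lemma abs_sub_le_of_mem_col {k c : ℕ} {x y : ℝ} (hx : x ∈ col l k c) (hy : y ∈ col l k c) :
    |x - y| ≤ 1 / cols l k := by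
  have e : ((c + 1 : ℕ) : ℝ) / cols l k = c / cols l k + 1 / cols l k := by push_cast; ring
  rw [col, Set.mem_Icc, e] at hx hy
  rw [abs_le]; constructor <;> linarith [hx.1, hx.2, hy.1, hy.2]

lemma col_child_subset (hl : ∀ k, Odd (l k)) {k c i : ℕ} (hi : i < 2 * l k) :
    col l (k + 1) (2 * l k * c + i) ⊆ col l k c := by
  have hN : (0 : ℝ) < cols l k := by exact_mod_cast cols_pos hl k
  have hlk : (0 : ℝ) < l k := by exact_mod_cast (hl k).pos
  have hi' : (i : ℝ) + 1 ≤ 2 * l k := by exact_mod_cast hi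
  refine Icc_subset_Icc ?_ ?_ <;> rw [cols_succ, div_le_div_iff₀ (by push_cast; positivity)
    (by push_cast; positivity)] <;> push_cast <;>
    nlinarith [mul_nonneg hN.le (sub_nonneg.2 hi'), mul_nonneg hN.le (Nat.cast_nonneg' i : (0:ℝ) ≤ i)]

/-- The two ends of the column differ in height by 2⁻ᵏ, so one of them is at least half of that away
from `x`. It serves as the comparison point in the quasisymmetry condition. -/
lemma exists_far_in_col (hl : ∀ k, Odd (l k)) (hG : IsGraphMap l G) (k c : ℕ) (x : ℝ) :
    ∃ z ∈ col l k c, 1 / 2 / 2 ^ k ≤ dist (G x) (G z) := by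
  have hw := walk_step hl k c
  have h1 := height_eq_walk hl k c
  have h2 := height_eq_walk hl k (c + 1)
  have hab : |height l ((c + 1 : ℕ) / cols l k) - height l ((c : ℝ) / cols l k)| = 1 / 2 ^ k := by
    rw [h1, h2, ← sub_div, abs_div, abs_of_pos (show (0 : ℝ) < 2 ^ k by positivity)]
    congr 1
    rcases hw with h | h
    · have : (walk l k (c + 1) - walk l k c : ℝ) = 1 := by exact_mod_cast h
      rw [this]; simp
    · have : (walk l k (c + 1) - walk l k c : ℝ) = -1 := by exact_mod_cast h
      rw [this]; simp
  by_contra! hcon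
  have a1 := (hG.abs_height_le x _).trans_lt (hcon _ (left_mem_col k c))
  have a2 := (hG.abs_height_le x _).trans_lt (hcon _ (right_mem_col k c))
  have a3 := abs_sub_le (height l ((c + 1 : ℕ) / cols l k)) (height l x) (height l ((c : ℝ) / cols l k))
  rw [abs_sub_comm (height l ((c + 1 : ℕ) / cols l k)) (height l x), hab] at a3
  have e : (1 : ℝ) / 2 / 2 ^ k + 1 / 2 / 2 ^ k = 1 / 2 ^ k := by ring
  linarith

lemma isBounded_image (hh : IsQSParam G h η) {S : Set ℝ} (hS : S ⊆ Icc 0 1) :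
    Bornology.IsBounded (h '' S) :=
  ((isCompact_Icc.image_of_continuousOn hh.cont).isBounded).subset (image_mono hS)

/-- Points whose mutual distance is much smaller than the size of a column have images whose
distance is much smaller than the size of the image of that column. -/
lemma dist_le_mul_width (hl : ∀ k, Odd (l k)) (hG : IsGraphMap l G) (hh : IsQSParam G h η)
    {k c : ℕ} (hc : c < cols l k) {x y r : ℝ} (hx : x ∈ col l k c) (hy : y ∈ Icc (0 : ℝ) 1)
    (hr : dist (G x) (G y) ≤ r) :
    dist (h x) (h y) ≤ η (2 * 2 ^ k * r) * width l h k c := by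
  have hr0 : 0 ≤ r := dist_nonneg.trans hr
  obtain ⟨z, hz, hxz⟩ := exists_far_in_col hl hG k c x
  have hsub := col_subset_Icc hl hc
  have hpos : 0 < dist (G x) (G z) := lt_of_lt_of_le (by positivity) hxz
  have hne : x ≠ z := by rintro rfl; simp at hpos
  refine (hh.dist_le x (hsub hx) y hy z (hsub hz) hne).trans ?_
  have h1 : dist (G x) (G y) / dist (G x) (G z) ≤ 2 * 2 ^ k * r := by
    rw [div_le_iff₀ hpos]
    calc dist (G x) (G y) ≤ r := hr
      _ = 2 * 2 ^ k * r * (1 / 2 / 2 ^ k) := by field_simp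
      _ ≤ _ := by gcongr
  have h2 : dist (h x) (h z) ≤ width l h k c :=
    Metric.dist_le_diam_of_mem (isBounded_image hh hsub) (mem_image_of_mem _ hx)
      (mem_image_of_mem _ hz)
  have h3 := hh.mono (a := dist (G x) (G y) / dist (G x) (G z)) (b := 2 * 2 ^ k * r)
    (mem_Ici.2 (by positivity)) (mem_Ici.2 (by positivity)) h1
  exact mul_le_mul h3 h2 dist_nonneg (hh.nonneg _ (by positivity))

end ZigzagGraph

/-! ### Subadditivity of image sizes, and control of the loss -/

namespace ZigzagGraph
open Set Filter Topology

variable {l : ℕ → ℕ}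

lemma walk_pair (hl : ∀ k, Odd (l k)) {k j : ℕ} (c : ℕ) (hj : j < l k) :
    (walk l (k + 1) (2 * l k * c + 2 * j) = 2 * row l k c ∧
      walk l (k + 1) (2 * l k * c + 2 * j + 1 + 1) = 2 * (row l k c + 1)) ∨
    (walk l (k + 1) (2 * l k * c + 2 * j) = 2 * (row l k c + 1) ∧
      walk l (k + 1) (2 * l k * c + 2 * j + 1 + 1) = 2 * row l k c) := by
  rw [show 2 * l k * c + 2 * j + 1 + 1 = 2 * l k * c + (2 * j + 2) by ring,
    walk_succ hl (i := 2 * j) c (by omega), walk_succ hl (i := 2 * j + 2) c (by omega)]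
  have z0 : zig (2 * j) = 0 ∧ zig (2 * j + 2) = 2 ∨ zig (2 * j) = 2 ∧ zig (2 * j + 2) = 0 := by
    unfold zig; split_ifs <;> omega
  unfold row
  rcases walk_step hl k c with h | h <;> rcases z0 with ⟨a, b⟩ | ⟨a, b⟩ <;>
    rw [h, a, b] <;> omega

variable {X Y : Type*} [PseudoMetricSpace X] [PseudoMetricSpace Y] {G : ℝ → X} {h : ℝ → Y}
  {η : ℝ → ℝ}

/-- Each height over a column is attained in every pair of adjacent children. -/
lemma exists_height_eq (hl : ∀ k, Odd (l k)) {k j c : ℕ} (hj : j < l k) {p : ℝ}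
    (hp : p ∈ col l k c) :
    ∃ p' ∈ col l (k + 1) (2 * l k * c + 2 * j) ∪ col l (k + 1) (2 * l k * c + 2 * j + 1),
      height l p' = height l p := by
  set b := 2 * l k * c + 2 * j
  have hle1 := (left_mem_col (l := l) (k + 1) b).2
  have hle2 := (left_mem_col (l := l) (k + 1) (b + 1)).2
  have hsub : uIcc ((b : ℝ) / cols l (k + 1)) ((b + 1 + 1 : ℕ) / cols l (k + 1)) ⊆ Ici 0 := by
    rw [uIcc_of_le (hle1.trans hle2)]
    exact fun x hx => le_trans (by positivity) hx.1
  have hiv := intermediate_value_uIcc ((continuousOn_height hl).mono hsub)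
  have hmem := height_mem hl hp
  have e : ∀ r : ℤ, ((2 * r : ℤ) : ℝ) / 2 ^ (k + 1) = r / 2 ^ k := by
    intro r; push_cast; rw [pow_succ]; field_simp
  have hmem' : height l p ∈ uIcc (height l ((b : ℝ) / cols l (k + 1)))
      (height l ((b + 1 + 1 : ℕ) / cols l (k + 1))) := by
    rw [height_eq_walk hl, height_eq_walk hl]
    rcases walk_pair hl c hj with ⟨h1, h2⟩ | ⟨h1, h2⟩ <;> rw [h1, h2, e, e] <;> push_cast
    · exact Icc_subset_uIcc hmem
    · exact Icc_subset_uIcc' hmem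
  obtain ⟨p', hp', hpp⟩ := hiv hmem'
  rw [uIcc_of_le (hle1.trans hle2)] at hp'
  refine ⟨p', ?_, hpp⟩
  rcases le_total p' ((b + 1 : ℕ) / cols l (k + 1)) with h | h
  · exact Or.inl ⟨hp'.1, h⟩
  · exact Or.inr ⟨h, hp'.2⟩

lemma child_lt {k c i : ℕ} (hc : c < cols l k) (hi : i < 2 * l k) :
    2 * l k * c + i < cols l (k + 1) := by
  rw [cols_succ]; nlinarith

/-- The loss of the images of pairs of columns relative to the image of their parent. -/
noncomputable def loss (l : ℕ → ℕ) (η : ℝ → ℝ) (k : ℕ) : ℝ := 2 * η (4 / mult l k)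

/-- Any point over the parent moves horizontally to a point of the same height over the pair. The
move has length at most one column width, which is at most 4/L relative to half the height of a
child. Both endpoints of a distance are moved, hence the 2 in `loss`. -/
lemma width_le_pair (hl : ∀ k, Odd (l k)) (hG : IsGraphMap l G) (hh : IsQSParam G h η)
    {k j c : ℕ} (hc : c < cols l k) (hj : j < l k) :
    width l h k c ≤ (1 + loss l η k) * (width l h (k + 1) (2 * l k * c + 2 * j) +
      width l h (k + 1) (2 * l k * c + 2 * j + 1)) := by
  set b := 2 * l k * c + 2 * j with hb
  have hb0 : b < cols l (k + 1) := child_lt hc (by omega)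
  have hb1 : b + 1 < cols l (k + 1) := child_lt (i := 2 * j + 1) hc (by omega)
  have hs0 : col l (k + 1) b ⊆ col l k c := col_child_subset hl (by omega)
  have hs1 : col l (k + 1) (b + 1) ⊆ col l k c := col_child_subset (i := 2 * j + 1) hl (by omega)
  have hsub := col_subset_Icc hl hc
  have hL : (0 : ℝ) < mult l k := by exact_mod_cast mult_pos hl k
  set W := width l h (k + 1) b + width l h (k + 1) (b + 1)
  have hW0 : width l h (k + 1) b ≤ W := le_add_of_nonneg_right (width_nonneg _ _)
  have hW1 : width l h (k + 1) (b + 1) ≤ W := le_add_of_nonneg_left (width_nonneg _ _)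
  have hη : 0 ≤ η (4 / mult l k) := hh.nonneg _ (by positivity)
  have hWn : 0 ≤ W := (width_nonneg _ _).trans hW0
  have move : ∀ p ∈ col l k c, ∃ p' ∈ col l (k + 1) b ∪ col l (k + 1) (b + 1),
      dist (h p) (h p') ≤ η (4 / mult l k) * W := by
    intro p hp
    obtain ⟨p', hp', hpp⟩ := exists_height_eq hl hj hp
    refine ⟨p', hp', ?_⟩
    have hp'c : p' ∈ col l k c := (union_subset hs0 hs1) hp'
    have hd : dist (G p') (G p) ≤ 1 / cols l k := by
      refine (hG.dist_le _ _).trans ?_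
      rw [hpp, sub_self, abs_zero, add_zero]
      exact abs_sub_le_of_mem_col hp'c hp
    have e : (2 : ℝ) * 2 ^ (k + 1) * (1 / cols l k) = 4 / mult l k := by
      rw [cols_eq, pow_succ]; push_cast; field_simp; norm_num
    rw [dist_comm]
    rcases hp' with h' | h'
    · refine (dist_le_mul_width hl hG hh hb0 h' (hsub hp) hd).trans ?_
      rw [e]; gcongr
    · refine (dist_le_mul_width hl hG hh hb1 h' (hsub hp) hd).trans ?_
      rw [e]; gcongr
  have hbd0 := isBounded_image hh (col_subset_Icc hl hb0)
  have hbd1 := isBounded_image hh (col_subset_Icc hl hb1)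
  have inner : Metric.diam (h '' (col l (k + 1) b ∪ col l (k + 1) (b + 1))) ≤ W := by
    rw [image_union]
    exact Metric.diam_union' ⟨_, mem_image_of_mem _ (right_mem_col _ _),
      mem_image_of_mem _ (left_mem_col _ _)⟩
  have hbd : Bornology.IsBounded (h '' (col l (k + 1) b ∪ col l (k + 1) (b + 1))) := by
    rw [image_union]; exact hbd0.union hbd1
  refine Metric.diam_le_of_forall_dist_le (by unfold loss; positivity) ?_
  rintro _ ⟨p, hp, rfl⟩ _ ⟨q, hq, rfl⟩
  obtain ⟨p', hp', hpd⟩ := move p hp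
  obtain ⟨q', hq', hqd⟩ := move q hq
  have h3 := (Metric.dist_le_diam_of_mem hbd (mem_image_of_mem h hp')
    (mem_image_of_mem h hq')).trans inner
  rw [dist_comm] at hqd
  refine (dist_triangle4 (h p) (h p') (h q') (h q)).trans ?_
  unfold loss
  linarith

lemma mul_width_le_sum (hl : ∀ k, Odd (l k)) (hG : IsGraphMap l G) (hh : IsQSParam G h η)
    {k c : ℕ} (hc : c < cols l k) :
    l k * width l h k c ≤ (1 + loss l η k) *
      ∑ i ∈ Finset.range (2 * l k), width l h (k + 1) (2 * l k * c + i) := by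
  rw [sum_range_two_mul, Finset.mul_sum]
  have := Finset.card_nsmul_le_sum (Finset.range (l k)) (fun j => (1 + loss l η k) *
    (width l h (k + 1) (2 * l k * c + 2 * j) + width l h (k + 1) (2 * l k * c + (2 * j + 1))))
    (width l h k c) fun j hj => width_le_pair hl hG hh hc (Finset.mem_range.1 hj)
  rwa [Finset.card_range, nsmul_eq_mul] at this

/-- The accumulated loss up to generation `k`. -/
noncomputable def totalLoss (l : ℕ → ℕ) (η : ℝ → ℝ) (k : ℕ) : ℝ :=
  ∏ j ∈ Finset.range k, (1 + loss l η j)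

lemma loss_nonneg (hh : IsQSParam G h η) (k : ℕ) : 0 ≤ loss l η k :=
  mul_nonneg zero_le_two (hh.nonneg _ (by positivity))

lemma totalLoss_pos (hh : IsQSParam G h η) (k : ℕ) : 0 < totalLoss l η k :=
  Finset.prod_pos fun j _ => by have := loss_nonneg (l := l) hh j; positivity

/-- The share of the column `c` of generation `k` in the size of the image of the graph. -/
noncomputable def share (l : ℕ → ℕ) (h : ℝ → Y) (η : ℝ → ℝ) (k c : ℕ) : ℝ :=
  totalLoss l η k * width l h k c / mult l k

lemma share_nonneg (hh : IsQSParam G h η) (k c : ℕ) : 0 ≤ share l h η k c := by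
  have := totalLoss_pos (l := l) hh k
  have := width_nonneg (l := l) (h := h) k c
  unfold share; positivity

/-- The factor l k from averaging over the pairs is absorbed by `mult`, the factor 1 + loss by
`totalLoss`. -/
lemma share_le_sum (hl : ∀ k, Odd (l k)) (hG : IsGraphMap l G) (hh : IsQSParam G h η)
    {k c : ℕ} (hc : c < cols l k) :
    share l h η k c ≤ ∑ i ∈ Finset.range (2 * l k), share l h η (k + 1) (2 * l k * c + i) := by
  have hL : (0 : ℝ) < mult l k := by exact_mod_cast mult_pos hl k
  have hlk : (0 : ℝ) < l k := by exact_mod_cast (hl k).pos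
  have hA := totalLoss_pos (l := l) hh k
  have h1 := mul_width_le_sum hl hG hh hc
  unfold share
  rw [← Finset.sum_div, ← Finset.mul_sum, mult_succ, totalLoss, totalLoss,
    Finset.prod_range_succ, ← totalLoss, div_le_div_iff₀ hL (by push_cast; positivity)]
  push_cast
  calc totalLoss l η k * width l h k c * (mult l k * l k)
      = totalLoss l η k * mult l k * (l k * width l h k c) := by ring
    _ ≤ totalLoss l η k * mult l k * ((1 + loss l η k) *
        ∑ i ∈ Finset.range (2 * l k), width l h (k + 1) (2 * l k * c + i)) := by gcongr
    _ = _ := by ring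

lemma exists_ancestor (hl : ∀ k, Odd (l k)) (k d : ℕ) {c : ℕ} (hc : c < cols l (k + d)) :
    ∃ c' < cols l k, col l (k + d) c ⊆ col l k c' := by
  induction d generalizing c with
  | zero => exact ⟨c, hc, subset_rfl⟩
  | succ d ih =>
    have hpos : 0 < 2 * l (k + d) := by have := (hl (k + d)).pos; omega
    rw [← add_assoc, cols_succ] at hc
    obtain ⟨c', h1, h2⟩ := ih (c := c / (2 * l (k + d)))
      (Nat.div_lt_of_lt_mul (by rwa [mul_comm] at hc))
    refine ⟨c', h1, subset_trans ?_ h2⟩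
    have := col_child_subset hl (k := k + d) (c := c / (2 * l (k + d))) (Nat.mod_lt c hpos)
    rwa [Nat.div_add_mod] at this

lemma dist_le_of_mem_col (hl : ∀ k, Odd (l k)) (hG : IsGraphMap l G) {k c : ℕ} {x y : ℝ}
    (hx : x ∈ col l k c) (hy : y ∈ col l k c) : dist (G x) (G y) ≤ 2 / 2 ^ k := by
  refine (hG.dist_le x y).trans ?_
  have h1 := (abs_sub_le_of_mem_col hx hy).trans (one_div_cols_le hl k)
  have h2 := abs_height_sub_le hl hx hy
  have e : (2 : ℝ) / 2 ^ k = 1 / 2 ^ k + 1 / 2 ^ k := by ring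
  linarith

lemma width_descendant_le (hl : ∀ k, Odd (l k)) (hG : IsGraphMap l G) (hh : IsQSParam G h η)
    (k d : ℕ) {c : ℕ} (hc : c < cols l (k + d)) :
    ∃ c' < cols l k, width l h (k + d) c ≤ η (4 / 2 ^ d) * width l h k c' := by
  obtain ⟨c', hc', hsub⟩ := exists_ancestor hl k d hc
  refine ⟨c', hc', ?_⟩
  have hη : 0 ≤ η (4 / 2 ^ d) := hh.nonneg _ (by positivity)
  refine Metric.diam_le_of_forall_dist_le (mul_nonneg hη (width_nonneg _ _)) ?_
  rintro _ ⟨p, hp, rfl⟩ _ ⟨q, hq, rfl⟩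
  have := dist_le_mul_width hl hG hh hc' (hsub hp) (col_subset_Icc hl hc hq)
    (dist_le_of_mem_col hl hG hp hq)
  have e : (2 : ℝ) * 2 ^ k * (2 / 2 ^ (k + d)) = 4 / 2 ^ d := by
    rw [pow_add]; field_simp; norm_num
  rwa [e] at this

lemma col_zero : col l 0 0 = Icc 0 1 := by simp [col, cols_zero]

lemma width_le_root (hl : ∀ k, Odd (l k)) (hh : IsQSParam G h η) {k c : ℕ} (hc : c < cols l k) :
    width l h k c ≤ width l h 0 0 := by
  refine Metric.diam_mono (image_mono ?_) (isBounded_image hh ?_)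
  · rw [col_zero]; exact col_subset_Icc hl hc
  · rw [col_zero]

lemma tendsto_eta (hh : IsQSParam G h η) {s : ℕ → ℝ} (hs0 : ∀ n, 0 ≤ s n)
    (hs : Tendsto s atTop (𝓝 0)) : Tendsto (fun n => η (s n)) atTop (𝓝 0) :=
  hh.tendsto.comp (tendsto_nhdsWithin_iff.2 ⟨hs, Eventually.of_forall hs0⟩)

/-- Since η tends to 0 at 0, there is a fixed d such that image sizes at least halve every d
generations. The factor 2 takes care of the generations before d. -/
lemma exists_width_le_geometric (hl : ∀ k, Odd (l k)) (hG : IsGraphMap l G)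
    (hh : IsQSParam G h η) :
    ∃ θ : ℝ, 0 < θ ∧ θ < 1 ∧ ∀ k, ∀ c < cols l k,
      width l h k c ≤ 2 * width l h 0 0 * θ ^ k := by
  have ht : Tendsto (fun d : ℕ => η (4 / 2 ^ d)) atTop (𝓝 0) := by
    refine tendsto_eta hh (fun n => by positivity) ?_
    have := (tendsto_pow_atTop_nhds_zero_of_lt_one (r := (1 / 2 : ℝ))
      (by norm_num) (by norm_num)).const_mul 4
    simpa [div_eq_mul_inv] using this
  obtain ⟨d, hd, hd1⟩ := ((ht.eventually (eventually_le_nhds (show (0 : ℝ) < 1 / 2 by norm_num))).and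
    (eventually_ge_atTop 1)).exists
  have hd0 : (d : ℝ) ≠ 0 := by positivity
  set θ : ℝ := (1 / 2 : ℝ) ^ (1 / d : ℝ)
  have hθ0 : 0 < θ := Real.rpow_pos_of_pos (by norm_num) _
  have hθ1 : θ < 1 := Real.rpow_lt_one (by norm_num) (by norm_num) (by positivity)
  have hθd : θ ^ d = 1 / 2 := by
    rw [← Real.rpow_natCast, ← Real.rpow_mul (by norm_num), one_div_mul_cancel hd0, Real.rpow_one]
  refine ⟨θ, hθ0, hθ1, fun k => ?_⟩
  have hW : 0 ≤ width l h 0 0 := width_nonneg _ _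
  induction k using Nat.strong_induction_on with
  | _ k ih =>
    intro c hc
    rcases lt_or_ge k d with hk | hk
    · refine (width_le_root hl hh hc).trans ?_
      have : 1 / 2 ≤ θ ^ k := by
        rw [← hθd]; exact pow_le_pow_of_le_one hθ0.le hθ1.le hk.le
      nlinarith
    · obtain ⟨m, rfl⟩ := Nat.exists_eq_add_of_le' hk
      obtain ⟨c', hc', h1⟩ := width_descendant_le hl hG hh m d hc
      have h2 := ih m (by omega) c' hc'
      calc width l h (m + d) c ≤ 1 / 2 * width l h m c' :=
            h1.trans (by gcongr; exact width_nonneg _ _)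
        _ ≤ 1 / 2 * (2 * width l h 0 0 * θ ^ m) := by gcongr
        _ = _ := by rw [pow_add, hθd]; ring

/-- The factors tend to 1 because L → ∞, so all but finitely many are at most ρ. -/
lemma exists_totalLoss_le (hh : IsQSParam G h η)
    (hL : Tendsto (mult l) atTop atTop) {ρ : ℝ} (hρ : 1 < ρ) :
    ∃ C, 0 < C ∧ ∀ k, totalLoss l η k ≤ C * ρ ^ k := by
  have ht : Tendsto (fun k => η (4 / mult l k)) atTop (𝓝 0) :=
    tendsto_eta hh (fun n => by positivity)
      (tendsto_const_nhds.div_atTop (tendsto_natCast_atTop_atTop.comp hL))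
  obtain ⟨J, hJ⟩ := eventually_atTop.1
    (ht.eventually (eventually_le_nhds (show (0 : ℝ) < (ρ - 1) / 2 by linarith)))
  refine ⟨totalLoss l η J, totalLoss_pos hh J, fun k => ?_⟩
  have h1 : ∀ j, 1 ≤ 1 + loss l η j := fun j => by linarith [loss_nonneg (l := l) hh j]
  induction k with
  | zero =>
    rw [pow_zero, mul_one, totalLoss, Finset.prod_range_zero]
    exact Finset.one_le_prod fun j _ => h1 j
  | succ k ih =>
    rcases le_or_gt J k with hk | hk
    · have h2 : 1 + loss l η k ≤ ρ := by unfold loss; linarith [hJ k hk]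
      rw [totalLoss, Finset.prod_range_succ, ← totalLoss, pow_succ, ← mul_assoc]
      exact mul_le_mul ih h2 (by linarith [h1 k]) ((totalLoss_pos hh k).le.trans ih)
    · have h3 : totalLoss l η (k + 1) ≤ totalLoss l η J :=
        Finset.prod_le_prod_of_subset_of_one_le (Finset.range_subset_range.2 hk)
          (fun j _ => by linarith [h1 j]) fun j _ _ => h1 j
      exact h3.trans (le_mul_of_one_le_right (totalLoss_pos hh J).le (one_le_pow₀ hρ.le))

/-- The power 1 - κ of the image size decays like θ^((1-κ)k); the loss is allowed to grow at exactly
the inverse rate. -/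
lemma exists_totalLoss_mul_width_le (hl : ∀ k, Odd (l k)) (hG : IsGraphMap l G)
    (hh : IsQSParam G h η) (hL : Tendsto (mult l) atTop atTop) {κ : ℝ} (h0 : 0 ≤ κ) (h1 : κ < 1) :
    ∃ C, 0 < C ∧ ∀ k, ∀ c < cols l k,
      totalLoss l η k * width l h k c ≤ C * width l h k c ^ κ := by
  obtain ⟨θ, hθ0, hθ1, hw⟩ := exists_width_le_geometric hl hG hh
  have hτ0 : 0 < θ ^ (1 - κ) := Real.rpow_pos_of_pos hθ0 _
  have hτ1 : θ ^ (1 - κ) < 1 := Real.rpow_lt_one hθ0.le hθ1 (by linarith)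
  obtain ⟨C, hC, hA⟩ := exists_totalLoss_le (l := l) hh hL (one_lt_inv_iff₀.2 ⟨hτ0, hτ1⟩)
  have hW : 0 ≤ width l h 0 0 := width_nonneg _ _
  refine ⟨C * (2 * width l h 0 0 + 1) ^ (1 - κ), by positivity, fun k c hc => ?_⟩
  have hwn : 0 ≤ width l h k c := width_nonneg _ _
  have e : width l h k c = width l h k c ^ κ * width l h k c ^ (1 - κ) := by
    rw [← Real.rpow_add_of_nonneg hwn h0 (by linarith)]; simp
  have h2 : width l h k c ^ (1 - κ) ≤ (2 * width l h 0 0 + 1) ^ (1 - κ) * (θ ^ (1 - κ)) ^ k := by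
    rw [← Real.rpow_natCast (θ ^ (1 - κ)), ← Real.rpow_mul hθ0.le, mul_comm (1 - κ),
      Real.rpow_mul hθ0.le, Real.rpow_natCast, ← Real.mul_rpow (by positivity) (by positivity)]
    refine Real.rpow_le_rpow hwn ((hw k c hc).trans ?_) (by linarith)
    gcongr; linarith
  calc totalLoss l η k * width l h k c
      = totalLoss l η k * (width l h k c ^ κ * width l h k c ^ (1 - κ)) := by rw [← e]
    _ ≤ C * (θ ^ (1 - κ))⁻¹ ^ k * (width l h k c ^ κ *
        ((2 * width l h 0 0 + 1) ^ (1 - κ) * (θ ^ (1 - κ)) ^ k)) := by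
      gcongr
      exact hA k
    _ = C * (2 * width l h 0 0 + 1) ^ (1 - κ) * width l h k c ^ κ *
        ((θ ^ (1 - κ))⁻¹ ^ k * (θ ^ (1 - κ)) ^ k) := by ring
    _ = _ := by rw [← mul_pow, inv_mul_cancel₀ hτ0.ne', one_pow, mul_one]

end ZigzagGraph

/-! ### Mass of balls as powers of the radius, and sums over covers -/

namespace ZigzagGraph
open Set Filter Topology MeasureTheory

variable {l : ℕ → ℕ}

lemma cols_le_succ (hl : ∀ k, Odd (l k)) (k : ℕ) : cols l k ≤ cols l (k + 1) := by
  rw [cols_succ]; exact Nat.le_mul_of_pos_right _ (by have := (hl k).pos; omega)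

lemma exists_scale (hl : ∀ k, Odd (l k)) {R : ℝ} (h0 : 0 < R) (h1 : R ≤ 1) :
    ∃ k, 1 / cols l (k + 1) ≤ R ∧ R ≤ 1 / cols l k := by
  classical
  have hex : ∃ k, (1 : ℝ) / cols l k ≤ R := by
    obtain ⟨j, hj, -⟩ := exists_dyadic h0 h1
    exact ⟨j, (one_div_cols_le hl j).trans hj⟩
  have hs := Nat.find_spec hex
  rcases hk : Nat.find hex with _ | k
  · rw [hk] at hs
    refine ⟨0, le_trans ?_ hs, by simpa [cols_zero] using h1⟩
    have : (0 : ℝ) < cols l 0 := by exact_mod_cast cols_pos hl 0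
    gcongr
    exact cols_le_succ hl 0
  · rw [hk] at hs
    exact ⟨k, hs, (not_le.1 (Nat.find_min hex (m := k) (by omega))).le⟩

lemma exists_volume_near_le (hl : ∀ k, Odd (l k)) {a : ℝ} (ha : 0 ≤ a)
    (hU : ∃ C : ℝ, 0 < C ∧ ∀ k, (cols l (k + 1) : ℝ) ^ a ≤ C * mult l k) :
    ∃ C : ℝ, 0 < C ∧ ∀ x₀ R, 0 < R → volume.real (near l x₀ R) ≤ C * R ^ (1 + a) := by
  obtain ⟨C, hC, hU⟩ := hU
  refine ⟨21 * C + 2, by positivity, fun x₀ R hR => ?_⟩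
  have hRa : 0 < R ^ a := Real.rpow_pos_of_pos hR _
  rw [Real.rpow_add hR, Real.rpow_one]
  rcases le_total R 1 with h1 | h1
  · obtain ⟨k, hk1, hk2⟩ := exists_scale hl hR h1
    have hL : (0 : ℝ) < mult l k := by exact_mod_cast mult_pos hl k
    have hN : (0 : ℝ) < cols l (k + 1) := by exact_mod_cast cols_pos hl (k + 1)
    have h2 : 1 / (mult l k : ℝ) ≤ C * R ^ a := by
      rw [div_le_iff₀ hL]
      have h3 : 1 ≤ (R * cols l (k + 1)) ^ a :=
        Real.one_le_rpow (by rwa [div_le_iff₀ hN] at hk1) ha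
      rw [Real.mul_rpow hR.le hN.le] at h3
      -- With R between the column widths of generations k+1 and k, 1/L is at most C N^(-a) for N =
      -- `cols l (k + 1)`, hence at most C R^a.
      nlinarith [mul_le_mul_of_nonneg_left (hU k) hRa.le]
    calc volume.real (near l x₀ R) ≤ 21 * R / mult l k := volume_near_le hl hR hk2
      _ = 21 * R * (1 / mult l k) := by ring
      _ ≤ 21 * R * (C * R ^ a) := by gcongr
      _ ≤ (21 * C + 2) * (R * R ^ a) := by nlinarith [mul_pos hR hRa]
  · have h2 : volume.real (near l x₀ R) ≤ 2 * R := by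
      refine (measureReal_mono (near_subset_Icc x₀ R) measure_Icc_lt_top.ne).trans ?_
      rw [Real.volume_real_Icc_of_le (by linarith)]; linarith
    have h3 : 1 ≤ R ^ a := Real.one_le_rpow h1 ha
    nlinarith [mul_pos hC (mul_pos hR hRa)]

lemma exists_le_volume_near (hl : ∀ k, Odd (l k)) {b : ℝ} (hb : 0 ≤ b)
    (hV : ∃ C : ℝ, 0 < C ∧ ∀ k, (cols l (k + 1) * mult l (k + 1) : ℝ) ≤ C * cols l k ^ b) :
    ∃ c : ℝ, 0 < c ∧ ∀ x₀ R, 0 ≤ x₀ → 0 < R → R ≤ 2 → c * R ^ b ≤ volume.real (near l x₀ R) := by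
  obtain ⟨C, hC, hV⟩ := hV
  have small : ∀ x₀ R, 0 ≤ x₀ → 0 < R → R ≤ 1 →
      1 / (2 * C) * R ^ b ≤ volume.real (near l x₀ R) := by
    intro x₀ R hx hR h1
    obtain ⟨k, hk1, hk2⟩ := exists_scale hl hR h1
    have hL : (0 : ℝ) < mult l (k + 1) := by exact_mod_cast mult_pos hl (k + 1)
    have hN : (0 : ℝ) < cols l (k + 1) := by exact_mod_cast cols_pos hl (k + 1)
    have hN' : (0 : ℝ) < cols l k := by exact_mod_cast cols_pos hl k
    refine le_trans ?_ (le_volume_near hl hx hk1)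
    have h3 : (R * cols l k) ^ b ≤ 1 :=
      Real.rpow_le_one (by positivity) (by rwa [le_div_iff₀ hN'] at hk2) hb
    rw [Real.mul_rpow hR.le hN'.le] at h3
    have hRb : 0 < R ^ b := Real.rpow_pos_of_pos hR _
    rw [div_mul_eq_mul_div, one_mul, div_le_div_iff₀ (by positivity) (by positivity)]
    nlinarith [mul_le_mul_of_nonneg_left (hV k) hRb.le]
  refine ⟨1 / (2 * C) / 2 ^ b, by positivity, fun x₀ R hx hR h2 => ?_⟩
  have h2b : (1 : ℝ) ≤ 2 ^ b := Real.one_le_rpow (by norm_num) hb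
  rcases le_total R 1 with h1 | h1
  · refine le_trans ?_ (small x₀ R hx hR h1)
    exact mul_le_mul_of_nonneg_right (div_le_self (by positivity) h2b) (by positivity)
  · have hsub : near l x₀ 1 ⊆ near l x₀ R := fun x hx' =>
      ⟨hx'.1, hx'.2.1.trans h1, hx'.2.2.trans h1⟩
    refine le_trans ?_ ((small x₀ 1 hx one_pos le_rfl).trans
      (measureReal_mono hsub (volume_near_ne_top _ _)))
    rw [Real.one_rpow, mul_one, div_mul_eq_mul_div]
    refine div_le_of_le_mul₀ (by positivity) (by positivity) ?_
    gcongr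

lemma isClosed_near (hl : ∀ k, Odd (l k)) (x₀ R : ℝ) : IsClosed (near l x₀ R) := by
  have h1 : IsClosed (Ici (0 : ℝ) ∩ (fun x => |height l x - height l x₀|) ⁻¹' Iic R) :=
    (((continuousOn_height hl).sub continuousOn_const).abs).preimage_isClosed_of_isClosed
      isClosed_Ici isClosed_Iic
  have h2 : IsClosed {x : ℝ | |x - x₀| ≤ R} := isClosed_le (by fun_prop) (by fun_prop)
  convert h1.inter h2 using 1
  ext x
  simp only [near, mem_ofPred_eq, mem_inter_iff, mem_Ici, mem_preimage, mem_Iic]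
  tauto

variable {X Y : Type*} [PseudoMetricSpace X] [PseudoMetricSpace Y] {G : ℝ → X} {h : ℝ → Y}
  {η : ℝ → ℝ}

lemma exists_dyadic_of_le_twenty {R : ℝ} (h0 : 0 < R) (h1 : R ≤ 20) :
    ∃ j : ℕ, (1 : ℝ) / 2 ^ j ≤ R ∧ (2 : ℝ) ^ j ≤ 20 / R := by
  rcases le_total R 1 with h | h
  · obtain ⟨j, hj1, hj2⟩ := exists_dyadic h0 h
    refine ⟨j, hj1, ?_⟩
    rw [le_div_iff₀ h0]
    rw [lt_div_iff₀ (by positivity)] at hj2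
    linarith
  · exact ⟨0, by simpa using h, by rw [le_div_iff₀ h0]; simpa using h1⟩

lemma sum_biUnion_le {ι α : Type*} [DecidableEq α] (s : Finset ι) (t : ι → Finset α)
    {f : α → ℝ} (hf : ∀ x, 0 ≤ f x) :
    ∑ x ∈ s.biUnion t, f x ≤ ∑ i ∈ s, ∑ x ∈ t i, f x := by
  classical
  induction s using Finset.induction_on with
  | empty => simp
  | insert i s hi ih =>
    rw [Finset.biUnion_insert, Finset.sum_insert hi]
    have := Finset.sum_union_inter (s₁ := t i) (s₂ := s.biUnion t) (f := f)
    have h0 : 0 ≤ ∑ x ∈ t i ∩ s.biUnion t, f x := Finset.sum_nonneg fun x _ => hf x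
    linarith

/-- Every finite cover of the graph by balls carries a definite part of the size of its image. -/
lemma exists_width_le_sum (hl : ∀ k, Odd (l k)) (hG : IsGraphMap l G)
    (hh : IsQSParam G h η) (hL : Tendsto (mult l) atTop atTop) {κ a : ℝ} (h0 : 0 ≤ κ) (h1 : κ < 1)
    (ha : 0 ≤ a) (hU : ∃ C : ℝ, 0 < C ∧ ∀ k, (cols l (k + 1) : ℝ) ^ a ≤ C * mult l k) :
    ∃ C, 0 < C ∧ ∀ (I : Finset ℕ) (x R s : ℕ → ℝ), (∀ i, 0 < R i) → (∀ i, R i ≤ 20) →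
      (∀ i, 0 ≤ s i) →
      (∀ y ∈ Icc (0 : ℝ) 1, ∃ i ∈ I, dist (G y) (G (x i)) ≤ R i) →
      (∀ i, ∀ y ∈ Icc (0 : ℝ) 1, dist (G y) (G (x i)) ≤ 3 * R i → dist (h y) (h (x i)) ≤ s i) →
      width l h 0 0 ≤ C * ∑ i ∈ I, s i ^ κ * R i ^ a := by
  classical
  obtain ⟨C₁, hC₁, hw⟩ := exists_totalLoss_mul_width_le hl hG hh hL h0 h1
  obtain ⟨C₂, hC₂, hv⟩ := exists_volume_near_le hl ha hU
  refine ⟨C₁ * 2 ^ κ * (20 * C₂ * 3 ^ (1 + a)), by positivity, ?_⟩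
  intro I x R s hR hR20 hs hcov hball
  -- Columns of generation j with 2⁻ʲ ≤ R have diameter at most 2R, so those meeting a ball of
  -- radius R lie in the ball of radius 3R.
  choose j hj1 hj2 using fun i => exists_dyadic_of_le_twenty (hR i) (hR20 i)
  let S : ℕ → Finset ℕ := fun i => {c ∈ Finset.range (cols l (j i)) |
    ∃ y ∈ col l (j i) c, dist (G y) (G (x i)) ≤ R i}
  let T : ℕ → Finset ℕ := fun k => ({i ∈ I | j i = k}).biUnion S
  obtain ⟨K, hK⟩ : ∃ K, ∀ i ∈ I, j i < K :=
    ⟨I.sup j + 1, fun i hi => Nat.lt_succ_of_le (Finset.le_sup hi)⟩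
  have hfar : ∀ i, ∀ c ∈ S i, ∀ y ∈ col l (j i) c, dist (G y) (G (x i)) ≤ 3 * R i := by
    intro i c hc y hy
    obtain ⟨-, z, hz, hzx⟩ := Finset.mem_filter.1 hc
    have h3 := dist_le_of_mem_col hl hG hy hz
    have e : (2 : ℝ) / 2 ^ j i = 2 * (1 / 2 ^ j i) := by ring
    have := dist_triangle (G y) (G z) (G (x i))
    linarith [hj1 i]
  have hcolI : ∀ i, ∀ c ∈ S i, c < cols l (j i) := fun i c hc =>
    Finset.mem_range.1 (Finset.mem_filter.1 hc).1
  have hwidth : ∀ i, ∀ c ∈ S i, width l h (j i) c ≤ 2 * s i := by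
    intro i c hc
    refine Metric.diam_le_of_forall_dist_le (by linarith [hs i]) ?_
    rintro _ ⟨p, hp, rfl⟩ _ ⟨q, hq, rfl⟩
    have hsub := col_subset_Icc hl (hcolI i c hc)
    have h3 := hball i p (hsub hp) (hfar i c hc p hp)
    have h4 := hball i q (hsub hq) (hfar i c hc q hq)
    have := dist_triangle_right (h p) (h q) (h (x i))
    linarith
  -- Counting by length: disjoint columns of length 1/N in a set of length at most C₂(3R)^(1+a).
  -- Since N/L = 2ʲ ≤ 20/R, one power of R cancels.
  have hcard : ∀ i, ((S i).card : ℝ) / mult l (j i) ≤ 20 * C₂ * 3 ^ (1 + a) * R i ^ a := by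
    intro i
    have hN : (0 : ℝ) < cols l (j i) := by exact_mod_cast cols_pos hl (j i)
    have hL' : (0 : ℝ) < mult l (j i) := by exact_mod_cast mult_pos hl (j i)
    have h3 : ((S i).card : ℝ) * (1 / cols l (j i)) ≤ volume.real (near l (x i) (3 * R i)) := by
      calc ((S i).card : ℝ) * (1 / cols l (j i))
          = ∑ c ∈ S i, volume.real (hcol l (j i) c) := by
            simp [volume_hcol hl]
        _ = volume.real (⋃ c ∈ S i, hcol l (j i) c) := by
            rw [measureReal_biUnion_finset (h := ?_)]
            · exact fun a _ b _ hab => pairwise_disjoint_hcol (j i) hab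
            · exact fun c _ => measurableSet_hcol hl _ _
            · intro c _; rw [hcol_eq_Ico hl]; exact measure_Ico_lt_top.ne
        _ ≤ _ := by
            refine measureReal_mono (iUnion₂_subset fun c hc y hy => ?_) (volume_near_ne_top _ _)
            have h4 := hfar i c hc y (hcol_subset_col hl _ _ hy)
            exact ⟨hy.1, (hG.abs_sub_le _ _).trans h4, (hG.abs_height_le _ _).trans h4⟩
    have h4 := h3.trans (hv (x i) (3 * R i) (by linarith [hR i]))
    rw [Real.mul_rpow (by norm_num) (hR i).le, Real.rpow_add (hR i), Real.rpow_one] at h4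
    have e : ((S i).card : ℝ) / mult l (j i) = 2 ^ j i * (((S i).card : ℝ) * (1 / cols l (j i))) := by
      rw [cols_eq]; push_cast; field_simp
    have hRa : 0 < R i ^ a := Real.rpow_pos_of_pos (hR i) _
    have hRi := hR i
    calc ((S i).card : ℝ) / mult l (j i)
        = 2 ^ j i * (((S i).card : ℝ) * (1 / cols l (j i))) := e
      _ ≤ 20 / R i * (C₂ * (3 ^ (1 + a) * (R i * R i ^ a))) := by
          gcongr; exact hj2 i
      _ = _ := by field_simp
  have hanc : ∀ c < cols l K, HasAncestor l T K c := by
    intro c hc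
    have hN : (0 : ℝ) < cols l K := by exact_mod_cast cols_pos hl K
    set y : ℝ := (c : ℝ) / cols l K
    have hy0 : 0 ≤ y := by positivity
    have hy1 : y < 1 := by rw [div_lt_one hN]; exact_mod_cast hc
    have hfl : ⌊cols l K * y⌋₊ = c := by
      rw [mul_div_cancel₀ _ hN.ne', Nat.floor_natCast]
    obtain ⟨i, hi, hyi⟩ := hcov y ⟨hy0, hy1.le⟩
    rw [← hfl]
    refine hasAncestor_of_mem hl (hK i hi) ?_
    have hNj : (0 : ℝ) < cols l (j i) := by exact_mod_cast cols_pos hl (j i)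
    refine Finset.mem_biUnion.2 ⟨i, Finset.mem_filter.2 ⟨hi, rfl⟩, Finset.mem_filter.2
      ⟨Finset.mem_range.2 ?_, y, mem_col_floor hl _ hy0, hyi⟩⟩
    rw [Nat.floor_lt (by positivity)]
    nlinarith
  have hroot : width l h 0 0 = share l h η 0 0 := by
    simp [share, totalLoss, mult_zero]
  -- Columns to the right of 1 get weight zero, since nothing is known of `h` there.
  have hsum := le_sum_of_hasAncestor hl (u := fun k c => if c < cols l k then share l h η k c else 0)
    (fun k c => by split_ifs; exacts [share_nonneg hh _ _, le_rfl])
    (fun k c hc => by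
      rw [if_pos hc, Finset.sum_congr rfl fun i hi =>
        if_pos (child_lt hc (Finset.mem_range.1 hi))]
      exact share_le_sum hl hG hh hc) T K hanc
  rw [if_pos (cols_pos hl 0), ← hroot] at hsum
  have hif : ∀ k c, 0 ≤ if c < cols l k then share l h η k c else 0 := by
    intro k c; split_ifs; exacts [share_nonneg hh _ _, le_rfl]
  refine hsum.trans ?_
  calc ∑ k ∈ Finset.range K, ∑ c ∈ T k, (if c < cols l k then share l h η k c else 0)
      ≤ ∑ k ∈ Finset.range K, ∑ i ∈ I with j i = k, ∑ c ∈ S i,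
          (if c < cols l k then share l h η k c else 0) :=
        Finset.sum_le_sum fun k _ => sum_biUnion_le _ _ (hif k)
    _ = ∑ k ∈ Finset.range K, ∑ i ∈ I with j i = k, ∑ c ∈ S i, share l h η (j i) c := by
        refine Finset.sum_congr rfl fun k _ => Finset.sum_congr rfl fun i hi =>
          Finset.sum_congr rfl fun c hc => ?_
        rw [← (Finset.mem_filter.1 hi).2, if_pos (hcolI i c hc)]
    _ = ∑ i ∈ I, ∑ c ∈ S i, share l h η (j i) c :=
        Finset.sum_fiberwise_of_maps_to (fun i hi => Finset.mem_range.2 (hK i hi)) _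
    _ ≤ ∑ i ∈ I, C₁ * 2 ^ κ * (20 * C₂ * 3 ^ (1 + a)) * (s i ^ κ * R i ^ a) := by
        refine Finset.sum_le_sum fun i _ => ?_
        have hL' : (0 : ℝ) < mult l (j i) := by exact_mod_cast mult_pos hl (j i)
        calc ∑ c ∈ S i, share l h η (j i) c
            ≤ ∑ _c ∈ S i, C₁ * (2 * s i) ^ κ / mult l (j i) := by
              refine Finset.sum_le_sum fun c hc => ?_
              unfold share
              refine div_le_div_of_nonneg_right ((hw _ c (hcolI i c hc)).trans ?_) hL'.le
              exact mul_le_mul_of_nonneg_left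
                (Real.rpow_le_rpow (width_nonneg _ _) (hwidth i c hc) h0) hC₁.le
          _ = C₁ * (2 ^ κ * s i ^ κ) * (((S i).card : ℝ) / mult l (j i)) := by
              rw [Finset.sum_const, nsmul_eq_mul, Real.mul_rpow zero_le_two (hs i)]; ring
          _ ≤ C₁ * (2 ^ κ * s i ^ κ) * (20 * C₂ * 3 ^ (1 + a) * R i ^ a) := by
              have := Real.rpow_nonneg (hs i) κ
              gcongr
              exact hcard i
          _ = _ := by ring
    _ = _ := by rw [← Finset.mul_sum]

end ZigzagGraph

/-! ### Lower bound for the dimension of quasisymmetric images -/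

namespace ZigzagGraph
open Set Filter Topology MeasureTheory

lemma exists_near_max {α : Type*} {S : Set α} {φ : α → ℝ} (hb : BddAbove (φ '' S))
    (hpos : ∃ z ∈ S, 0 < φ z) : ∃ z ∈ S, 0 < φ z ∧ ∀ z' ∈ S, φ z' ≤ 2 * φ z := by
  obtain ⟨z₀, hz₀, h0⟩ := hpos
  have h1 := le_csSup hb (mem_image_of_mem φ hz₀)
  obtain ⟨_, ⟨z, hz, rfl⟩, hlt⟩ := exists_lt_of_lt_csSup (s := φ '' S) ⟨_, mem_image_of_mem φ hz₀⟩
    (show sSup (φ '' S) / 2 < sSup (φ '' S) by linarith)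
  refine ⟨z, hz, by linarith, fun z' hz' => ?_⟩
  have := le_csSup hb (mem_image_of_mem φ hz')
  linarith

/-- A set of vanishing Hausdorff measure has covers by balls with small sum of powers of radii. -/
lemma exists_cover_of_hausdorffMeasure_eq_zero {Y : Type*} [MetricSpace Y] [MeasurableSpace Y]
    [BorelSpace Y] {S : Set Y} {p : ℝ} (hp : 0 < p) (hS : μH[p] S = 0) {δ : ℝ} (hδ : 0 < δ) :
    ∃ (t : ℕ → Set Y) (r : ℕ → ℝ), (S ⊆ ⋃ n, t n) ∧ (∀ n, 0 < r n) ∧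
      (∀ n, ∀ y ∈ t n, ∀ y' ∈ t n, dist y y' < r n) ∧
      ∀ F : Finset ℕ, ∑ n ∈ F, r n ^ p ≤ δ := by
  rw [Measure.hausdorffMeasure_apply] at hS
  have h1 := (ENNReal.iSup_eq_zero.1 (ENNReal.iSup_eq_zero.1 hS 1)) one_pos
  have h2 : (⨅ (t : ℕ → Set Y) (_ : S ⊆ ⋃ n, t n) (_ : ∀ n, Metric.ediam (t n) ≤ 1),
      ∑' n, ⨆ _ : (t n).Nonempty, Metric.ediam (t n) ^ p) < ENNReal.ofReal (δ / 2) := by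
    rw [h1]; simpa using hδ
  simp only [iInf_lt_iff] at h2
  obtain ⟨t, ht, hd, hsum⟩ := h2
  have hne : ∀ n, Metric.ediam (t n) ≠ ⊤ := fun n => ((hd n).trans_lt ENNReal.one_lt_top).ne
  set d : ℕ → ℝ := fun n => (Metric.ediam (t n)).toReal
  have hd0 : ∀ n, 0 ≤ d n := fun n => ENNReal.toReal_nonneg
  have he : ∀ n : ℕ, 0 < δ / 2 / 2 ^ (n + 1) := fun n => by positivity
  have hdp : ∀ n, 0 ≤ d n ^ p := fun n => Real.rpow_nonneg (hd0 n) p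
  have hrp : ∀ n, ((d n ^ p + δ / 2 / 2 ^ (n + 1)) ^ (1 / p)) ^ p =
      d n ^ p + δ / 2 / 2 ^ (n + 1) := fun n => by
    rw [← Real.rpow_mul (by linarith [hdp n, he n]), one_div_mul_cancel hp.ne', Real.rpow_one]
  have hrpos : ∀ n, 0 < (d n ^ p + δ / 2 / 2 ^ (n + 1)) ^ (1 / p) := fun n =>
    Real.rpow_pos_of_pos (by linarith [hdp n, he n]) _
  -- The summable extra term makes the radii positive and strictly larger than the diameters, even
  -- for sets reduced to a point.
  refine ⟨t, fun n => (d n ^ p + δ / 2 / 2 ^ (n + 1)) ^ (1 / p), ht, hrpos, ?_, ?_⟩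
  · intro n y hy y' hy'
    have h3 : dist y y' ≤ d n := by
      rw [dist_edist]
      exact ENNReal.toReal_mono (hne n) (Metric.edist_le_ediam_of_mem hy hy')
    refine h3.trans_lt ?_
    rw [← Real.rpow_lt_rpow_iff (hd0 n) (hrpos n).le hp, hrp]
    linarith [he n]
  · intro F
    simp only [hrp, Finset.sum_add_distrib]
    have h4 : ∑ n ∈ F, d n ^ p ≤ δ / 2 := by
      rw [← ENNReal.ofReal_le_ofReal_iff (by positivity),
        ENNReal.ofReal_sum_of_nonneg fun n _ => hdp n]
      refine le_trans ?_ hsum.le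
      refine le_trans (Finset.sum_le_sum fun n _ => ?_) (ENNReal.sum_le_tsum F)
      rw [← ENNReal.ofReal_rpow_of_nonneg (hd0 n) hp.le, ENNReal.ofReal_toReal (hne n)]
      rcases (t n).eq_empty_or_nonempty with h | h
      · simp [h, hp]
      · simp [h]
    have h5 : ∑ n ∈ F, δ / 2 / 2 ^ (n + 1) ≤ δ / 2 := by
      have hsm : HasSum (fun n : ℕ => δ / 2 / 2 / 2 ^ n) (δ / 2) := hasSum_geometric_two' _
      have := sum_le_hasSum F (fun n _ => by positivity) hsm
      refine le_trans (le_of_eq ?_) this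
      refine Finset.sum_congr rfl fun n _ => ?_
      rw [pow_succ]; field_simp
    linarith

variable {l : ℕ → ℕ} {X Y : Type*} [PseudoMetricSpace X] [MetricSpace Y] {G : ℝ → X} {h : ℝ → Y}
  {η : ℝ → ℝ}

lemma dist_le_two (hl : ∀ k, Odd (l k)) (hG : IsGraphMap l G) {x y : ℝ} (hx : x ∈ Icc (0 : ℝ) 1)
    (hy : y ∈ Icc (0 : ℝ) 1) : dist (G x) (G y) ≤ 2 := by
  rw [← col_zero (l := l)] at hx hy
  simpa using dist_le_of_mem_col hl hG hx hy

/-- Balls in the image pull back to sets comparable to balls. -/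
lemma exists_pullback_radius (hl : ∀ k, Odd (l k)) (hG : IsGraphMap l G) (hh : IsQSParam G h η)
    {x r : ℝ} (hx : x ∈ Icc (0 : ℝ) 1) (hr : 0 < r) :
    ∃ R, 0 < R ∧ R ≤ 4 ∧
      (∀ y ∈ Icc (0 : ℝ) 1, dist (h y) (h x) < r → dist (G y) (G x) ≤ R) ∧
      ∀ y ∈ Icc (0 : ℝ) 1, dist (G y) (G x) ≤ 15 * R → dist (h y) (h x) ≤ η 30 * r := by
  have hpos : ∃ z ∈ {y ∈ Icc (0 : ℝ) 1 | dist (h y) (h x) < r}, 0 < dist (G z) (G x) := by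
    obtain ⟨δ, hδ, hc⟩ := Metric.continuousOn_iff.1 hh.cont x hx r hr
    obtain ⟨z, hz, hzx, hzδ⟩ : ∃ z ∈ Icc (0 : ℝ) 1, z ≠ x ∧ dist z x < δ := by
      rcases lt_or_ge x (1 / 2) with h | h
      · refine ⟨x + min (δ / 2) (1 / 2), ⟨?_, ?_⟩, ?_, ?_⟩
        · have : 0 ≤ min (δ / 2) (1 / 2 : ℝ) := by positivity
          linarith [hx.1]
        · linarith [min_le_right (δ / 2) (1 / 2 : ℝ)]
        · have : 0 < min (δ / 2) (1 / 2 : ℝ) := by positivity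
          linarith
        · have : 0 < min (δ / 2) (1 / 2 : ℝ) := by positivity
          rw [Real.dist_eq, add_sub_cancel_left, abs_of_pos this]
          linarith [min_le_left (δ / 2) (1 / 2 : ℝ)]
      · refine ⟨x - min (δ / 2) (1 / 2), ⟨?_, ?_⟩, ?_, ?_⟩
        · linarith [min_le_right (δ / 2) (1 / 2 : ℝ)]
        · have : 0 ≤ min (δ / 2) (1 / 2 : ℝ) := by positivity
          linarith [hx.2]
        · have : 0 < min (δ / 2) (1 / 2 : ℝ) := by positivity
          linarith
        · have : 0 < min (δ / 2) (1 / 2 : ℝ) := by positivity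
          rw [Real.dist_eq, sub_sub_cancel_left, abs_neg, abs_of_pos this]
          linarith [min_le_left (δ / 2) (1 / 2 : ℝ)]
    refine ⟨z, ⟨hz, hc z hz hzδ⟩, lt_of_lt_of_le ?_ (hG.abs_sub_le z x)⟩
    rw [abs_pos]; exact sub_ne_zero.2 hzx
  obtain ⟨z, ⟨hz, hzr⟩, hz0, hzmax⟩ := exists_near_max (φ := fun z => dist (G z) (G x))
    ⟨2, by rintro _ ⟨y, hy, rfl⟩; exact dist_le_two hl hG hy.1 hx⟩ hpos
  -- The factor 2 pays for `z` being only nearly farthest. Then 15R is 30 times the distance to `z`,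
  -- whence η 30; the 15 is the Vitali factor 5 times the factor 3 of `exists_width_le_sum`.
  refine ⟨2 * dist (G z) (G x), by positivity, by linarith [dist_le_two hl hG hz hx],
    fun y hy hyr => hzmax y ⟨hy, hyr⟩, fun y hy hyR => ?_⟩
  have hne : x ≠ z := by rintro rfl; simp at hz0
  rw [dist_comm (h y)]
  rw [dist_comm (G y), dist_comm (G z)] at hyR
  rw [dist_comm (G z)] at hz0
  have hle : dist (G x) (G y) / dist (G x) (G z) ≤ 30 := by
    rw [div_le_iff₀ hz0]; linarith
  refine (hh.dist_le x hx y hy z hz hne).trans ?_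
  rw [dist_comm (h z)] at hzr
  exact mul_le_mul (hh.mono (mem_Ici.2 (by positivity)) (mem_Ici.2 (by norm_num)) hle) hzr.le
    dist_nonneg (hh.nonneg _ (by norm_num))

/-- Quasisymmetric images of the zigzag graph have large Hausdorff dimension. -/
theorem le_dimH_image (hl : ∀ k, Odd (l k)) (hG : IsGraphMap l G)
    (hh : IsQSParam G h η) (hL : Tendsto (mult l) atTop atTop) {a b : ℝ} (ha : 0 < a)
    (hab : a < b)
    (hU : ∃ C : ℝ, 0 < C ∧ ∀ k, (cols l (k + 1) : ℝ) ^ a ≤ C * mult l k)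
    (hV : ∃ C : ℝ, 0 < C ∧ ∀ k, (cols l (k + 1) * mult l (k + 1) : ℝ) ≤ C * cols l k ^ b)
    (hinj : h 0 ≠ h 1) {p : ℝ≥0} (hp0 : 0 < p) (hp : (p : ℝ) < b / (b - a)) :
    (p : ℝ≥0∞) ≤ dimH (h '' Icc 0 1) := by
  by_contra! hlt
  borelize Y
  have hzero := hausdorffMeasure_of_dimH_lt hlt
  have hb : 0 < b := ha.trans hab
  have hba : 0 < b - a := sub_pos.2 hab
  have hp0' : (0 : ℝ) < p := hp0
  set q : ℝ := b / (b - a) with hq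
  have hqpos : 0 < q := by positivity
  have hconj : q.HolderConjugate (b / a) := by
    rw [Real.holderConjugate_iff]
    refine ⟨by rw [hq, one_lt_div hba]; linarith, ?_⟩
    rw [hq, inv_div, inv_div]; field_simp; ring
  set κ : ℝ := p / q with hκ
  have hκ0 : 0 ≤ κ := by positivity
  have hκ1 : κ < 1 := by rwa [hκ, div_lt_one hqpos]
  obtain ⟨C, hC, hcore⟩ := exists_width_le_sum hl hG hh hL hκ0 hκ1 ha.le hU
  obtain ⟨c, hc, hlow⟩ := exists_le_volume_near hl hb.le hV
  have hW : 0 < width l h 0 0 := by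
    refine (dist_pos.2 hinj).trans_le (Metric.dist_le_diam_of_mem (isBounded_image hh ?_)
      (mem_image_of_mem h ?_) (mem_image_of_mem h ?_)) <;> rw [col_zero] <;> norm_num
  have hη : 0 ≤ η 30 := hh.nonneg _ (by norm_num)
  set M : ℝ := C * ((η 30) ^ κ * 5 ^ a) * (3 * 2 ^ b / c) ^ (1 / (b / a)) + 1 with hM
  have hMpos : 0 < M := by positivity
  -- Chosen so that the final estimate bounds the size of the whole image by half of itself.
  set δ : ℝ := (width l h 0 0 / (2 * M)) ^ q with hδdef
  have hδ : 0 < δ := by positivity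
  have hδq : δ ^ (1 / q) = width l h 0 0 / (2 * M) := by
    rw [hδdef, ← Real.rpow_mul (by positivity), mul_one_div_cancel hqpos.ne', Real.rpow_one]
  obtain ⟨t, r, ht, hr, htr, hsum⟩ := exists_cover_of_hausdorffMeasure_eq_zero hp0' hzero hδ
  -- Sets of the cover that miss the image get the dummy center 0; the extra balls are harmless.
  have hx : ∀ n, ∃ x ∈ Icc (0 : ℝ) 1, (t n ∩ h '' Icc 0 1).Nonempty → h x ∈ t n := by
    intro n
    by_cases hn : (t n ∩ h '' Icc 0 1).Nonempty
    · obtain ⟨_, hy, x, hx, rfl⟩ := hn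
      exact ⟨x, hx, fun _ => hy⟩
    · exact ⟨0, by norm_num, fun h' => absurd h' hn⟩
  choose x hxI hxt using hx
  choose R hR0 hR4 hRin hRout using fun n => exists_pullback_radius hl hG hh (hxI n) (hr n)
  have hopen : h '' Icc 0 1 ⊆ ⋃ n, Metric.ball (h (x n)) (r n) := by
    intro y hy
    obtain ⟨n, hn⟩ := mem_iUnion.1 (ht hy)
    exact mem_iUnion.2 ⟨n, htr n y hn _ (hxt n ⟨y, hn, hy⟩)⟩
  obtain ⟨F, hF⟩ := (isCompact_Icc.image_of_continuousOn hh.cont).elim_finite_subcover _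
    (fun n => Metric.isOpen_ball) hopen
  -- The selection is made in the graph, not in the image: disjointness there bounds the sum of R^b,
  -- and the fivefold balls still cover.
  obtain ⟨u, huF, hdisj, hu⟩ := Vitali.exists_disjoint_subfamily_covering_enlargement_closedBall
    (F : Set ℕ) (fun n => G (x n)) R 4 (fun n _ => hR4 n) 5 (by norm_num)
  lift u to Finset ℕ using F.finite_toSet.subset huF
  have hη' : ∀ n, 0 ≤ η 30 * r n := fun n => mul_nonneg hη (hr n).le
  have hmain := hcore u x (fun n => 5 * R n) (fun n => η 30 * r n)
    (fun n => by linarith [hR0 n]) (fun n => by linarith [hR4 n]) hη'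
    (by
      intro y hy
      obtain ⟨n, hnF, hn⟩ := mem_iUnion₂.1 (hF (mem_image_of_mem h hy))
      obtain ⟨m, hm, hsub⟩ := hu n hnF
      exact ⟨m, hm, hsub (hRin n y hy hn)⟩)
    (fun n y hy hyd => hRout n y hy (by linarith))
  -- The parameter sets of radius R/2 map into the disjoint balls, as `IsGraphMap` bounds the
  -- distance by the sum of the coordinate differences. They lie in [0, 3] since R/2 ≤ 2.
  have hvol : ∑ n ∈ u, R n ^ b ≤ 3 * 2 ^ b / c := by
    have hRb : ∀ n, R n ^ b = 2 ^ b / c * (c * (R n / 2) ^ b) := by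
      intro n
      rw [Real.div_rpow (hR0 n).le zero_le_two]; field_simp
    have hball : ∀ n, ∀ y ∈ near l (x n) (R n / 2), G y ∈ Metric.closedBall (G (x n)) (R n) := by
      rintro n y ⟨-, h1, h2⟩
      rw [Metric.mem_closedBall]
      linarith [hG.dist_le y (x n)]
    calc ∑ n ∈ u, R n ^ b = 2 ^ b / c * ∑ n ∈ u, c * (R n / 2) ^ b := by
          rw [Finset.mul_sum]; exact Finset.sum_congr rfl fun n _ => hRb n
      _ ≤ 2 ^ b / c * ∑ n ∈ u, volume.real (near l (x n) (R n / 2)) := by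
          gcongr with n
          exact hlow _ _ (hxI n).1 (by linarith [hR0 n]) (by linarith [hR4 n])
      _ = 2 ^ b / c * volume.real (⋃ n ∈ u, near l (x n) (R n / 2)) := by
          rw [measureReal_biUnion_finset (h := ?_)]
          · intro n hn m hm hnm
            refine Set.disjoint_left.2 fun y h1 h2 => ?_
            exact Set.disjoint_left.1 (hdisj hn hm hnm) (hball n y h1) (hball m y h2)
          · exact fun n _ => (isClosed_near hl _ _).measurableSet
          · exact fun n _ => volume_near_ne_top _ _
      _ ≤ 2 ^ b / c * volume.real (Icc (0 : ℝ) 3) := by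
          gcongr
          · exact measure_Icc_lt_top.ne
          refine iUnion₂_subset fun n _ y hy => ⟨hy.1, ?_⟩
          have := (near_subset_Icc _ _ hy).2
          linarith [(hxI n).2, hR4 n]
      _ = 3 * 2 ^ b / c := by rw [Real.volume_real_Icc_of_le (by norm_num)]; ring
  have hholder := Real.inner_le_Lp_mul_Lq u (fun n => r n ^ κ) (fun n => R n ^ a) hconj
  have e1 : ∀ n, |r n ^ κ| ^ q = r n ^ (p : ℝ) := fun n => by
    rw [abs_of_nonneg (Real.rpow_nonneg (hr n).le _), ← Real.rpow_mul (hr n).le, hκ,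
      div_mul_cancel₀ _ hqpos.ne']
  have e2 : ∀ n, |R n ^ a| ^ (b / a) = R n ^ b := fun n => by
    rw [abs_of_nonneg (Real.rpow_nonneg (hR0 n).le _), ← Real.rpow_mul (hR0 n).le,
      mul_div_cancel₀ _ ha.ne']
  simp only [e1, e2] at hholder
  have hfin : width l h 0 0 ≤ M * (width l h 0 0 / (2 * M)) := by
    calc width l h 0 0 ≤ C * ∑ n ∈ u, (η 30 * r n) ^ κ * (5 * R n) ^ a := hmain
      _ = C * ((η 30) ^ κ * 5 ^ a) * ∑ n ∈ u, r n ^ κ * R n ^ a := by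
          rw [Finset.mul_sum, Finset.mul_sum]
          refine Finset.sum_congr rfl fun n _ => ?_
          rw [Real.mul_rpow hη (hr n).le, Real.mul_rpow (by norm_num) (hR0 n).le]; ring
      _ ≤ C * ((η 30) ^ κ * 5 ^ a) * (δ ^ (1 / q) * (3 * 2 ^ b / c) ^ (1 / (b / a))) := by
          gcongr
          refine hholder.trans ?_
          have := hsum u
          have h1 : 0 ≤ ∑ n ∈ u, r n ^ (p : ℝ) :=
            Finset.sum_nonneg fun n _ => Real.rpow_nonneg (hr n).le _
          have h2 : 0 ≤ ∑ n ∈ u, R n ^ b :=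
            Finset.sum_nonneg fun n _ => Real.rpow_nonneg (hR0 n).le _
          gcongr
      _ = (M - 1) * (width l h 0 0 / (2 * M)) := by rw [hδq, hM]; ring
      _ ≤ M * (width l h 0 0 / (2 * M)) := by gcongr; linarith
  have : M * (width l h 0 0 / (2 * M)) = width l h 0 0 / 2 := by field_simp
  linarith

end ZigzagGraph

/-! ### Upper bound for the dimension of the graph -/

namespace ZigzagGraph
open Set Filter Topology MeasureTheory

variable {l : ℕ → ℕ}

lemma exists_mem_col (hl : ∀ k, Odd (l k)) (k : ℕ) {x : ℝ} (hx : x ∈ Icc (0 : ℝ) 1) :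
    ∃ c < cols l k, x ∈ col l k c := by
  have hN : (0 : ℝ) < cols l k := by exact_mod_cast cols_pos hl k
  rcases hx.2.lt_or_eq with h | rfl
  · refine ⟨_, ?_, mem_col_floor hl k hx.1⟩
    rw [Nat.floor_lt (by have := hx.1; positivity)]
    nlinarith
  · have h1 := cols_pos hl k
    refine ⟨cols l k - 1, by omega, ?_⟩
    have := right_mem_col (l := l) k (cols l k - 1)
    rwa [Nat.sub_add_cancel h1, div_self hN.ne'] at this

lemma tendsto_cols (hl : ∀ k, Odd (l k)) : Tendsto (fun k => (cols l k : ℝ)) atTop atTop := by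
  refine tendsto_atTop_mono (fun k => ?_)
    (tendsto_pow_atTop_atTop_of_one_lt (show (1 : ℝ) < 2 by norm_num))
  have := mult_pos hl k
  rw [cols_eq]; exact_mod_cast Nat.le_mul_of_pos_right _ this

/-- The Hausdorff dimension of the zigzag graph is bounded by its box dimension. -/
theorem dimH_graph_le {X : Type*} [MetricSpace X] {G : ℝ → X} (hl : ∀ k, Odd (l k))
    (hG : IsGraphMap l G) {b : ℝ≥0}
    (hV : ∃ C : ℝ, 0 < C ∧ ∀ k,
      (cols l (k + 1) * mult l (k + 1) : ℝ) ≤ C * (cols l k : ℝ) ^ (b : ℝ)) :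
    dimH (G '' Icc 0 1) ≤ b := by
  obtain ⟨C, hC, hV⟩ := hV
  borelize X
  apply dimH_le_of_hausdorffMeasure_ne_top
  -- Boxes of side 1/N, stacked over each column. A point on the top edge of its row has floor
  -- exactly L, hence L + 1 boxes.
  let t : ∀ n : ℕ, Fin (cols l (n + 1)) × Fin (mult l (n + 1) + 1) → Set X := fun n i =>
    G '' {y ∈ col l (n + 1) i.1 |
      ⌊(height l y - row l (n + 1) i.1 / 2 ^ (n + 1)) * cols l (n + 1)⌋₊ = i.2}
  have hN : ∀ n, (0 : ℝ) < cols l n := fun n => by exact_mod_cast cols_pos hl n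
  have hdiam : ∀ n i, Metric.ediam (t n i) ≤ ENNReal.ofReal (2 / cols l (n + 1)) := by
    intro n i
    refine Metric.ediam_le ?_
    rintro _ ⟨y, ⟨hy, hy'⟩, rfl⟩ _ ⟨z, ⟨hz, hz'⟩, rfl⟩
    rw [edist_dist]
    refine ENNReal.ofReal_le_ofReal ((hG.dist_le y z).trans ?_)
    have h1 := abs_sub_le_of_mem_col hy hz
    have h2 := height_mem hl hy
    have h3 := height_mem hl hz
    have hNn := hN (n + 1)
    rw [Nat.floor_eq_iff (mul_nonneg (sub_nonneg.2 h2.1) hNn.le)] at hy'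
    rw [Nat.floor_eq_iff (mul_nonneg (sub_nonneg.2 h3.1) hNn.le)] at hz'
    have h4 : |height l y - height l z| ≤ 1 / cols l (n + 1) := by
      rw [abs_le, neg_le_iff_add_nonneg, le_div_iff₀ hNn]
      constructor
      · have : 0 ≤ ((height l y - height l z) + 1 / cols l (n + 1)) * cols l (n + 1) := by
          rw [add_mul, one_div_mul_cancel hNn.ne']; nlinarith [hy'.1, hz'.2]
        exact nonneg_of_mul_nonneg_left this hNn
      · nlinarith [hy'.2, hz'.1]
    have e : (2 : ℝ) / cols l (n + 1) = 1 / cols l (n + 1) + 1 / cols l (n + 1) := by ring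
    linarith
  have hcover : ∀ n, G '' Icc 0 1 ⊆ ⋃ i, t n i := by
    rintro n _ ⟨x, hx, rfl⟩
    obtain ⟨c, hc, hxc⟩ := exists_mem_col hl (n + 1) hx
    have h2 := height_mem hl hxc
    refine mem_iUnion.2 ⟨(⟨c, hc⟩, ⟨⌊(height l x - row l (n + 1) c / 2 ^ (n + 1)) *
      cols l (n + 1)⌋₊, ?_⟩), x, ⟨hxc, rfl⟩, rfl⟩
    rw [Nat.lt_succ_iff]
    refine Nat.floor_le_of_le ?_
    have h3 := h2.2
    rw [add_div] at h3
    have h4 : height l x - row l (n + 1) c / 2 ^ (n + 1) ≤ 1 / 2 ^ (n + 1) := by linarith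
    calc (height l x - row l (n + 1) c / 2 ^ (n + 1)) * cols l (n + 1)
        ≤ 1 / 2 ^ (n + 1) * cols l (n + 1) := by gcongr
      _ = mult l (n + 1) := by rw [cols_eq]; push_cast; field_simp
  have htend : Tendsto (fun n => ENNReal.ofReal (2 / cols l (n + 1))) atTop (𝓝 0) := by
    have := ENNReal.tendsto_ofReal
      ((tendsto_const_nhds (x := (2 : ℝ))).div_atTop ((tendsto_cols hl).comp (tendsto_add_atTop_nat 1)))
    simpa using this
  have hle := Measure.hausdorffMeasure_le_liminf_sum (b : ℝ) (G '' Icc 0 1) _ htend t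
    (Eventually.of_forall hdiam) (Eventually.of_forall hcover)
  have hsum : ∀ n, ∑ i, Metric.ediam (t n i) ^ (b : ℝ) ≤ ENNReal.ofReal (2 * C * 2 ^ (b : ℝ)) := by
    intro n
    have hNn := hN (n + 1)
    have hL : (1 : ℝ) ≤ mult l (n + 1) := by exact_mod_cast mult_pos hl (n + 1)
    calc ∑ i, Metric.ediam (t n i) ^ (b : ℝ)
        ≤ ∑ _i : Fin (cols l (n + 1)) × Fin (mult l (n + 1) + 1),
            ENNReal.ofReal ((2 / cols l (n + 1)) ^ (b : ℝ)) := by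
          refine Finset.sum_le_sum fun i _ => ?_
          rw [← ENNReal.ofReal_rpow_of_nonneg (by positivity) b.coe_nonneg]
          exact ENNReal.rpow_le_rpow (hdiam n i) b.coe_nonneg
      _ = ENNReal.ofReal ((cols l (n + 1) * (mult l (n + 1) + 1)) *
            (2 / cols l (n + 1)) ^ (b : ℝ)) := by
          rw [Finset.sum_const, Finset.card_univ, Fintype.card_prod, Fintype.card_fin,
            Fintype.card_fin, nsmul_eq_mul, ENNReal.ofReal_mul (by positivity),
            ← ENNReal.ofReal_natCast]
          push_cast; rfl
      _ ≤ _ := by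
          refine ENNReal.ofReal_le_ofReal ?_
          have hNb : 0 < (cols l (n + 1) : ℝ) ^ (b : ℝ) := Real.rpow_pos_of_pos hNn _
          have h1 : (cols l n : ℝ) ^ (b : ℝ) ≤ (cols l (n + 1) : ℝ) ^ (b : ℝ) :=
            Real.rpow_le_rpow (hN n).le (by exact_mod_cast cols_le_succ hl n) b.coe_nonneg
          rw [Real.div_rpow zero_le_two hNn.le, ← mul_div_assoc, div_le_iff₀ hNb]
          calc (cols l (n + 1) * (mult l (n + 1) + 1) : ℝ) * 2 ^ (b : ℝ)
              ≤ (2 * (cols l (n + 1) * mult l (n + 1))) * 2 ^ (b : ℝ) := by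
                refine mul_le_mul_of_nonneg_right ?_ (by positivity)
                nlinarith
            _ ≤ (2 * (C * (cols l (n + 1) : ℝ) ^ (b : ℝ))) * 2 ^ (b : ℝ) := by
                refine mul_le_mul_of_nonneg_right ?_ (by positivity)
                exact mul_le_mul_of_nonneg_left
                  ((hV n).trans (mul_le_mul_of_nonneg_left h1 hC.le)) zero_le_two
            _ = _ := by ring
  have := hle.trans (liminf_le_liminf (Eventually.of_forall hsum))
  rw [liminf_const] at this
  exact (this.trans_lt ENNReal.ofReal_lt_top).ne

/-! ### Choice of the multiplicities -/

/-- The multiplicities for which `mult l k = 3 ^ e k`. -/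
def tripling (e : ℕ → ℕ) (k : ℕ) : ℕ := 3 ^ (e (k + 1) - e k)

lemma odd_tripling (e : ℕ → ℕ) (k : ℕ) : Odd (tripling e k) := Odd.pow (by decide)

lemma mult_tripling {e : ℕ → ℕ} (he : Monotone e) (h0 : e 0 = 0) (k : ℕ) :
    mult (tripling e) k = 3 ^ e k := by
  induction k with
  | zero => simp [mult_zero, h0]
  | succ k ih =>
    rw [mult_succ, ih, tripling, ← pow_add, Nat.add_sub_cancel' (he k.le_succ)]

lemma exists_growth_of_lt_two {d : ℝ} (hd1 : 1 < d) (hd2 : d < 2) :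
    ∃ l : ℕ → ℕ, (∀ k, Odd (l k)) ∧ Tendsto (mult l) atTop atTop ∧ ∀ a b : ℝ, 0 < a → a < d - 1 →
      d < b → (∃ C : ℝ, 0 < C ∧ ∀ k, (cols l (k + 1) : ℝ) ^ a ≤ C * mult l k) ∧
        ∃ C : ℝ, 0 < C ∧ ∀ k, (cols l (k + 1) * mult l (k + 1) : ℝ) ≤ C * cols l k ^ b := by
  have hlog2 : 0 < Real.log 2 := Real.log_pos (by norm_num)
  have hlog3 : 0 < Real.log 3 := Real.log_pos (by norm_num)
  have hd2' : 0 < 2 - d := by linarith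
  -- The solution of (2·3^t)^(d-1) = 3^t: with L close to 3^(kt), N is close to (2·3^t)^k and L to
  -- N^(d-1), up to bounded factors.
  set t : ℝ := (d - 1) * Real.log 2 / ((2 - d) * Real.log 3) with ht
  have ht0 : 0 < t := by have : 0 < d - 1 := by linarith
                         positivity
  set x : ℝ := 2 * 3 ^ t with hx
  have h3t : (0 : ℝ) < 3 ^ t := by positivity
  have hx0 : 0 < x := by positivity
  have h3t1 : (1 : ℝ) ≤ 3 ^ t := Real.one_le_rpow (by norm_num) ht0.le
  have hx1 : 1 ≤ x := by linarith
  have hxd : x ^ (d - 1) = 3 ^ t := by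
    apply Real.log_injOn_pos (mem_Ioi.2 (by positivity)) (mem_Ioi.2 h3t)
    rw [Real.log_rpow hx0, hx, Real.log_mul (by norm_num) h3t.ne', Real.log_rpow (by norm_num), ht]
    field_simp; ring
  set e : ℕ → ℕ := fun k => ⌊k * t⌋₊
  have he : Monotone e := fun i j hij => Nat.floor_mono (by gcongr)
  have he0 : e 0 = 0 := by simp [e]
  have hle : ∀ k, (3 : ℝ) ^ e k ≤ (3 ^ t) ^ k := fun k => by
    rw [← Real.rpow_natCast, ← Real.rpow_natCast, ← Real.rpow_mul (by norm_num), mul_comm t]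
    exact Real.rpow_le_rpow_of_exponent_le (by norm_num) (Nat.floor_le (by positivity))
  have hge : ∀ k, ((3 : ℝ) ^ t) ^ k ≤ 3 * 3 ^ e k := fun k => by
    rw [← pow_succ', ← Real.rpow_natCast, ← Real.rpow_natCast, ← Real.rpow_mul (by norm_num),
      mul_comm t]
    refine Real.rpow_le_rpow_of_exponent_le (by norm_num) ?_
    push_cast; exact (Nat.lt_floor_add_one _).le
  have hm : ∀ k, (mult (tripling e) k : ℝ) = 3 ^ e k := fun k => by
    rw [mult_tripling he he0]; push_cast; rfl
  have hc : ∀ k, (cols (tripling e) k : ℝ) = 2 ^ k * 3 ^ e k := fun k => by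
    rw [cols_eq]; push_cast; rw [hm]
  have hcx : ∀ k, (cols (tripling e) k : ℝ) ≤ x ^ k := fun k => by
    rw [hc, hx, mul_pow]; gcongr; exact hle k
  have hxc : ∀ k, x ^ k ≤ 3 * (cols (tripling e) k : ℝ) := fun k => by
    rw [hc, hx, mul_pow]
    nlinarith [mul_le_mul_of_nonneg_left (hge k) (show (0 : ℝ) ≤ 2 ^ k by positivity)]
  have hN1 : ∀ k, (1 : ℝ) ≤ cols (tripling e) k := fun k => by
    exact_mod_cast cols_pos (odd_tripling e) k
  have hpow : ∀ k : ℕ, (x ^ k) ^ (d - 1) = (3 ^ t) ^ k := fun k => by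
    rw [← Real.rpow_natCast, ← Real.rpow_mul hx0.le, mul_comm, Real.rpow_mul hx0.le, hxd,
      Real.rpow_natCast]
  refine ⟨tripling e, odd_tripling e, ?_, fun a b ha0 ha hb => ⟨⟨3 ^ t * 3, by positivity, fun k => ?_⟩,
    ⟨x ^ d * 3 ^ d, by positivity, fun k => ?_⟩⟩⟩
  · have : mult (tripling e) = fun k => 3 ^ e k := funext fun k => mult_tripling he he0 k
    rw [this]
    refine (tendsto_pow_atTop_atTop_of_one_lt (by norm_num)).comp ?_
    exact tendsto_nat_floor_atTop.comp (tendsto_natCast_atTop_atTop.atTop_mul_const ht0)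
  · calc (cols (tripling e) (k + 1) : ℝ) ^ a ≤ (x ^ (k + 1)) ^ a := by
          gcongr; exact hcx _
      _ ≤ (x ^ (k + 1)) ^ (d - 1) :=
          Real.rpow_le_rpow_of_exponent_le (one_le_pow₀ hx1) ha.le
      _ = 3 ^ t * (3 ^ t) ^ k := by rw [hpow, pow_succ']
      _ ≤ 3 ^ t * (3 * 3 ^ e k) := by gcongr; exact hge k
      _ = _ := by rw [hm]; ring
  · calc (cols (tripling e) (k + 1) : ℝ) * mult (tripling e) (k + 1)
        ≤ x ^ (k + 1) * (3 ^ t) ^ (k + 1) := by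
          rw [hm]; gcongr
          · exact hcx _
          · exact hle _
      _ = (x ^ (k + 1)) ^ d := by
          rw [← hpow, mul_comm, ← Real.rpow_add_one (by positivity), sub_add_cancel]
      _ = x ^ d * (x ^ k) ^ d := by
          rw [pow_succ', Real.mul_rpow hx0.le (by positivity)]
      _ ≤ x ^ d * (3 * cols (tripling e) k) ^ d := by gcongr; exact hxc k
      _ = x ^ d * 3 ^ d * (cols (tripling e) k : ℝ) ^ d := by
          rw [Real.mul_rpow (x := 3) (by norm_num) (by positivity)]; ring
      _ ≤ _ := by
          gcongr
          exact hN1 k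

/-- For d = 2 the factor 2ᵏ must be negligible against L, which forces superexponential growth, yet
consecutive generations must stay comparable up to small powers. L = 3^(k²) does both; the constants
come from completing squares in the exponents. -/
lemma exists_growth_two :
    ∃ l : ℕ → ℕ, (∀ k, Odd (l k)) ∧ Tendsto (mult l) atTop atTop ∧ ∀ a b : ℝ, 0 < a → a < 2 - 1 →
      2 < b → (∃ C : ℝ, 0 < C ∧ ∀ k, (cols l (k + 1) : ℝ) ^ a ≤ C * mult l k) ∧
        ∃ C : ℝ, 0 < C ∧ ∀ k, (cols l (k + 1) * mult l (k + 1) : ℝ) ≤ C * cols l k ^ b := by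
  set e : ℕ → ℕ := fun k => k ^ 2
  have he : Monotone e := fun i j hij => Nat.pow_le_pow_left hij 2
  have he0 : e 0 = 0 := by simp [e]
  have hm : ∀ k : ℕ, (mult (tripling e) k : ℝ) = 3 ^ ((k : ℝ) ^ 2) := fun k => by
    rw [mult_tripling he he0, ← Real.rpow_natCast (k : ℝ) 2, Nat.cast_ofNat, Real.rpow_ofNat,
      ← Nat.cast_pow, Real.rpow_natCast]; push_cast; rfl
  have hc : ∀ k : ℕ, (cols (tripling e) k : ℝ) ≤ 3 ^ ((k : ℝ) + (k : ℝ) ^ 2) := fun k => by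
    rw [cols_eq, Real.rpow_add (by norm_num), Real.rpow_natCast, ← hm]; push_cast
    gcongr; norm_num
  have hc' : ∀ k : ℕ, (3 : ℝ) ^ ((k : ℝ) ^ 2) ≤ cols (tripling e) k := fun k => by
    rw [cols_eq, ← hm]; push_cast
    exact le_mul_of_one_le_left (by positivity) (one_le_pow₀ (by norm_num))
  refine ⟨tripling e, odd_tripling e, ?_, fun a b ha0 ha hb =>
    ⟨⟨3 ^ (2 + 9 / (4 * (1 - a))), by positivity, fun k => ?_⟩,
    ⟨3 ^ (3 + 25 / (4 * (b - 2))), by positivity, fun k => ?_⟩⟩⟩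
  · have : mult (tripling e) = fun k => 3 ^ e k := funext fun k => mult_tripling he he0 k
    rw [this]
    exact (tendsto_pow_atTop_atTop_of_one_lt (by norm_num)).comp
      (tendsto_pow_atTop two_ne_zero)
  · have hs : 0 < 1 - a := by linarith
    calc (cols (tripling e) (k + 1) : ℝ) ^ a
        ≤ (3 ^ (((k + 1 : ℕ) : ℝ) + ((k + 1 : ℕ) : ℝ) ^ 2)) ^ a := by
          gcongr; exact hc _
      _ = 3 ^ ((((k + 1 : ℕ) : ℝ) + ((k + 1 : ℕ) : ℝ) ^ 2) * a) := by
          rw [← Real.rpow_mul (by norm_num)]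
      _ ≤ 3 ^ (2 + 9 / (4 * (1 - a)) + (k : ℝ) ^ 2) := by
          refine Real.rpow_le_rpow_of_exponent_le (by norm_num) ?_
          push_cast
          have h1 : 0 ≤ (1 - a) * (k - 3 / (2 * (1 - a))) ^ 2 := by positivity
          have h2 : (1 - a) * (k - 3 / (2 * (1 - a))) ^ 2 =
              (1 - a) * (k : ℝ) ^ 2 - 3 * k + 9 / (4 * (1 - a)) := by
            field_simp; ring
          nlinarith [(Nat.cast_nonneg k : (0 : ℝ) ≤ k)]
      _ = _ := by rw [Real.rpow_add (by norm_num), hm]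
  · have hs : 0 < b - 2 := by linarith
    calc (cols (tripling e) (k + 1) : ℝ) * mult (tripling e) (k + 1)
        ≤ 3 ^ (((k + 1 : ℕ) : ℝ) + ((k + 1 : ℕ) : ℝ) ^ 2) * 3 ^ (((k + 1 : ℕ) : ℝ) ^ 2) := by
          rw [hm]; gcongr; exact hc _
      _ = 3 ^ (((k + 1 : ℕ) : ℝ) + ((k + 1 : ℕ) : ℝ) ^ 2 + ((k + 1 : ℕ) : ℝ) ^ 2) := by
          rw [Real.rpow_add (by norm_num) (((k + 1 : ℕ) : ℝ) + ((k + 1 : ℕ) : ℝ) ^ 2)]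
      _ ≤ 3 ^ (3 + 25 / (4 * (b - 2)) + (k : ℝ) ^ 2 * b) := by
          refine Real.rpow_le_rpow_of_exponent_le (by norm_num) ?_
          push_cast
          have h1 : 0 ≤ (b - 2) * (k - 5 / (2 * (b - 2))) ^ 2 := by positivity
          have h2 : (b - 2) * (k - 5 / (2 * (b - 2))) ^ 2 =
              (b - 2) * (k : ℝ) ^ 2 - 5 * k + 25 / (4 * (b - 2)) := by
            field_simp; ring
          nlinarith
      _ = 3 ^ (3 + 25 / (4 * (b - 2))) * (3 ^ ((k : ℝ) ^ 2)) ^ b := by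
          rw [Real.rpow_add (by norm_num), Real.rpow_mul (by norm_num)]
      _ ≤ _ := by gcongr; exact hc' k

end ZigzagGraph

/-! ### The Euclidean graph and conclusion -/

namespace ZigzagGraph
open Set Filter Topology MeasureTheory

/-- The graph map into the Euclidean plane. -/
noncomputable def graphMap (f : ℝ → ℝ) (x : ℝ) : EuclideanSpace ℝ (Fin 2) := !₂[x, f x]

lemma dist_graphMap (f : ℝ → ℝ) (x y : ℝ) :
    dist (graphMap f x) (graphMap f y) = √((x - y) ^ 2 + (f x - f y) ^ 2) := by
  simp [graphMap, EuclideanSpace.dist_eq, Fin.sum_univ_two, Real.dist_eq, sq_abs]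

lemma isGraphMap_graphMap (l : ℕ → ℕ) : IsGraphMap l (graphMap (height l)) where
  abs_sub_le x y := by
    rw [dist_graphMap]; exact Real.abs_le_sqrt (by nlinarith [sq_nonneg (height l x - height l y)])
  abs_height_le x y := by
    rw [dist_graphMap]; exact Real.abs_le_sqrt (by nlinarith [sq_nonneg (x - y)])
  dist_le x y := by
    rw [dist_graphMap]
    refine Real.sqrt_le_iff.2 ⟨by positivity, ?_⟩
    nlinarith [sq_abs (x - y), sq_abs (height l x - height l y),
      mul_nonneg (abs_nonneg (x - y)) (abs_nonneg (height l x - height l y))]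

lemma image_graphMap (f : ℝ → ℝ) :
    graphMap f '' Icc 0 1 = euclideanGraph fun x => f x := by
  ext p; simp [euclideanGraph, graphMap]

/-- The point of the graph with parameter `x`. -/
def toGraph (f : Icc (0 : ℝ) 1 → ℝ) (x : Icc (0 : ℝ) 1) : euclideanGraph f :=
  ⟨!₂[(x : ℝ), f x], mem_range_self x⟩

lemma continuous_toGraph {f : Icc (0 : ℝ) 1 → ℝ} (hf : Continuous f) : Continuous (toGraph f) := by
  refine Continuous.subtype_mk ?_ _
  refine (PiLp.continuous_toLp 2 _).comp (continuous_pi fun i => ?_)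
  fin_cases i
  · exact continuous_subtype_val
  · exact hf

lemma surjective_toGraph (f : Icc (0 : ℝ) 1 → ℝ) : Function.Surjective (toGraph f) := by
  rintro ⟨_, x, rfl⟩; exact ⟨x, rfl⟩

lemma injective_toGraph (f : Icc (0 : ℝ) 1 → ℝ) : Function.Injective (toGraph f) := by
  intro x y hxy
  have := congrArg (fun p : euclideanGraph f => (p : EuclideanSpace ℝ (Fin 2)) 0) hxy
  exact Subtype.ext (by simpa [toGraph] using this)

lemma conformalDim_le_dimH.{u} (X : Type u) [MetricSpace X] :
    conformalDim X ≤ dimH (univ : Set X) :=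
  sInf_le ⟨X, inferInstance, Homeomorph.refl X,
    ⟨Homeomorph.refl _, fun _ _ _ _ => le_rfl⟩, rfl⟩

lemma dimH_univ_coe {X : Type*} [MetricSpace X] (S : Set X) : dimH (univ : Set S) = dimH S := by
  rw [← isometry_subtype_coe.dimH_image, image_univ, Subtype.range_coe]

/-- A space is minimal of dimension `d` if `d` bounds its Hausdorff dimension from above and the
Hausdorff dimensions of its quasisymmetric images from below. -/
lemma isMinimal_of_bounds.{u} {X : Type u} [MetricSpace X] {d : ℝ≥0∞}
    (h1 : dimH (univ : Set X) ≤ d)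
    (h2 : ∀ (Y : Type u) [MetricSpace Y] (g : X ≃ₜ Y), IsQuasisymmetric g →
      d ≤ dimH (univ : Set Y)) :
    IsMinimalForConformalDim X ∧ conformalDim X = d := by
  have h3 : d ≤ conformalDim X := le_sInf (by
    rintro _ ⟨Y, inst, g, hg, rfl⟩; exact h2 Y g hg)
  have h4 := conformalDim_le_dimH X
  exact ⟨le_antisymm h4 (h1.trans h3), le_antisymm (h4.trans h1) h3⟩

/-- The distance to a point is 1-Lipschitz, and by connectedness its range contains an interval. -/
lemma one_le_dimH_of_preconnected {Y : Type*} [MetricSpace Y] [PreconnectedSpace Y]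
    [Nontrivial Y] : 1 ≤ dimH (univ : Set Y) := by
  obtain ⟨y₀, y₁, hne⟩ := exists_pair_ne Y
  have hpos : 0 < dist y₁ y₀ := dist_pos.2 hne.symm
  have hcon := (isPreconnected_range (f := fun y : Y => dist y y₀) (by fun_prop)).Icc_subset
    (a := 0) (b := dist y₁ y₀) ⟨y₀, dist_self _⟩ ⟨y₁, rfl⟩
  have hint : (interior (range fun y : Y => dist y y₀)).Nonempty := by
    refine Nonempty.mono (interior_mono hcon) ?_
    rw [interior_Icc]; exact nonempty_Ioo.2 hpos
  have h1 := Real.dimH_of_nonempty_interior hint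
  rw [← Nat.cast_one, ← Module.finrank_self ℝ, ← h1]
  exact (LipschitzWith.dist_left y₀).dimH_range_le

lemma isQSParam_of_isQuasisymmetric {f : ℝ → ℝ}
    (hf : Continuous fun x : Icc (0 : ℝ) 1 => f x) {Y : Type*} [MetricSpace Y]
    {g : euclideanGraph (fun x : Icc (0 : ℝ) 1 => f x) ≃ₜ Y} (hg : IsQuasisymmetric g) :
    ∃ η : ℝ → ℝ, IsQSParam (graphMap f)
      (fun x => g (toGraph (fun x => f x) (projIcc 0 1 zero_le_one x))) η := by
  obtain ⟨η, hη⟩ := hg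
  -- An injective continuous self-map of [0, ∞) is strictly monotone or antitone; a decreasing one
  -- would be bounded by its value at 0 and not surjective.
  have hη0 : η 0 = 0 := by
    have hmono : StrictMono η ∨ StrictAnti η := η.continuous.strictMono_of_inj η.injective
    obtain ⟨t, ht⟩ := η.surjective 0
    rcases hmono with h | h
    · exact le_antisymm ((h.monotone (zero_le : (0 : ℝ≥0) ≤ t)).trans_eq ht) zero_le
    · obtain ⟨s, hs⟩ := η.surjective (η 0 + 1)
      have := h.antitone (zero_le : (0 : ℝ≥0) ≤ s)
      rw [hs] at this
      exact absurd this (by simp)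
  have hmono : StrictMono η := by
    rcases η.continuous.strictMono_of_inj η.injective with h | h
    · exact h
    · have := h (show (0 : ℝ≥0) < 1 by norm_num)
      rw [hη0] at this
      exact absurd this (not_lt.2 zero_le)
  refine ⟨fun t => η t.toNNReal, ⟨fun t _ => NNReal.coe_nonneg _, fun s _ t _ hst => ?_, ?_, ?_, ?_⟩⟩
  · exact_mod_cast hmono.monotone (Real.toNNReal_mono hst)
  · have hc : Continuous fun t : ℝ => (η t.toNNReal : ℝ) := by fun_prop
    have := hc.tendsto 0
    simp only [Real.toNNReal_zero, hη0, NNReal.coe_zero] at this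
    exact this.mono_left nhdsWithin_le_nhds
  · exact (g.continuous.comp ((continuous_toGraph hf).comp continuous_projIcc)).continuousOn
  · intro x hx y hy z hz hxz
    rw [projIcc_of_mem _ hx, projIcc_of_mem _ hy, projIcc_of_mem _ hz]
    have hne : toGraph (fun x : Icc (0 : ℝ) 1 => f x) ⟨x, hx⟩ ≠ toGraph (fun x => f x) ⟨z, hz⟩ :=
      fun h => hxz (congrArg Subtype.val (injective_toGraph _ h))
    have h1 := hη _ (toGraph (fun x => f x) ⟨y, hy⟩) _ hne
    have h2 : 0 < nndist (g (toGraph (fun x => f x) ⟨x, hx⟩))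
        (g (toGraph (fun x => f x) ⟨z, hz⟩)) :=
      pos_iff_ne_zero.2 fun h => hne (g.injective (nndist_eq_zero.1 h))
    rw [div_le_iff₀ h2] at h1
    have h3 : (dist (graphMap f x) (graphMap f y) / dist (graphMap f x) (graphMap f z)).toNNReal =
        nndist (toGraph (fun x : Icc (0 : ℝ) 1 => f x) ⟨x, hx⟩) (toGraph (fun x => f x) ⟨y, hy⟩) /
        nndist (toGraph (fun x : Icc (0 : ℝ) 1 => f x) ⟨x, hx⟩) (toGraph (fun x => f x) ⟨z, hz⟩) := by
      rw [Real.toNNReal_div dist_nonneg]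
      congr 1 <;> exact NNReal.eq (Real.coe_toNNReal _ dist_nonneg)
    rw [h3]
    exact_mod_cast h1

theorem exists_minimal_graph_one :
    ∃ f : Icc (0 : ℝ) 1 → ℝ, Continuous f ∧ IsMinimalForConformalDim (euclideanGraph f) ∧
      conformalDim (euclideanGraph f) = 1 := by
  refine ⟨fun _ => 0, continuous_const, isMinimal_of_bounds ?_ fun Y _ g _ => ?_⟩
  · have hlip : LipschitzWith 1 (graphMap fun _ => 0) := LipschitzWith.of_dist_le_mul fun x y => by
      rw [dist_graphMap]; simp [Real.sqrt_sq_eq_abs, Real.dist_eq]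
    rw [dimH_univ_coe, ← image_graphMap fun _ => 0]
    refine (hlip.dimH_image_le _).trans ((dimH_mono (subset_univ _)).trans ?_)
    rw [Real.dimH_univ]
  · set γ := g ∘ toGraph fun _ => 0
    have hγ : Continuous γ := g.continuous.comp (continuous_toGraph continuous_const)
    have hs : Function.Surjective γ := g.surjective.comp (surjective_toGraph _)
    have hi : Function.Injective γ := g.injective.comp (injective_toGraph _)
    have : PreconnectedSpace Y := hs.denseRange.preconnectedSpace hγ
    have : Nontrivial Y := hi.nontrivial
    exact one_le_dimH_of_preconnected

theorem exists_minimal_graph {d : ℝ} (hd1 : 1 < d) (hd2 : d ≤ 2) :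
    ∃ f : Icc (0 : ℝ) 1 → ℝ, Continuous f ∧ IsMinimalForConformalDim (euclideanGraph f) ∧
      conformalDim (euclideanGraph f) = ENNReal.ofReal d := by
  obtain ⟨l, hl, hL, hgrow⟩ : ∃ l : ℕ → ℕ, (∀ k, Odd (l k)) ∧ Tendsto (mult l) atTop atTop ∧
      ∀ a b : ℝ, 0 < a → a < d - 1 → d < b →
      (∃ C : ℝ, 0 < C ∧ ∀ k, (cols l (k + 1) : ℝ) ^ a ≤ C * mult l k) ∧
        ∃ C : ℝ, 0 < C ∧ ∀ k, (cols l (k + 1) * mult l (k + 1) : ℝ) ≤ C * cols l k ^ b := by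
    rcases hd2.lt_or_eq with h | rfl
    · exact exists_growth_of_lt_two hd1 h
    · exact exists_growth_two
  have hG := isGraphMap_graphMap l
  have hcont : Continuous fun x : Icc (0 : ℝ) 1 => height l x :=
    continuousOn_iff_continuous_domRestrict.1
      ((continuousOn_height hl).mono Icc_subset_Ici_self)
  refine ⟨fun x => height l x, hcont, isMinimal_of_bounds ?_ fun Y _ g hg => ?_⟩
  · rw [dimH_univ_coe, ← image_graphMap]
    refine le_of_forall_gt_imp_ge_of_dense fun c hc => ?_
    rcases eq_or_ne c ⊤ with rfl | hct
    · exact le_top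
    lift c to ℝ≥0 using hct
    have hdc : d < c := by
      rw [ENNReal.ofReal_lt_iff_lt_toReal (by linarith) ENNReal.coe_ne_top] at hc
      simpa using hc
    exact dimH_graph_le hl hG (hgrow ((d - 1) / 2) c (by linarith) (by linarith) hdc).2
  · obtain ⟨η, hh⟩ := isQSParam_of_isQuasisymmetric hcont hg
    refine le_of_forall_lt_imp_le_of_dense fun c hc => ?_
    lift c to ℝ≥0 using (hc.trans ENNReal.ofReal_lt_top).ne
    have hcd : (c : ℝ) < d := by
      rw [ENNReal.lt_ofReal_iff_toReal_lt ENNReal.coe_ne_top] at hc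
      simpa using hc
    rcases eq_or_ne c 0 with rfl | hc0
    · simp
    -- With a = d-1-τ and b = d+τ, the requirement c < b/(b-a) reads (2c-1)τ < d-c, which τ ≤
    -- (d-c)/4 ensures since c < 2; the second bound keeps a positive.
    set τ : ℝ := min ((d - c) / 4) ((d - 1) / 2)
    have hτ0 : 0 < τ := lt_min (by linarith) (by linarith)
    have hτ1 : τ ≤ (d - c) / 4 := min_le_left _ _
    have hτ2 : τ ≤ (d - 1) / 2 := min_le_right _ _
    obtain ⟨hU, hV⟩ := hgrow (d - 1 - τ) (d + τ) (by linarith) (by linarith) (by linarith)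
    refine (le_dimH_image hl hG hh hL (by linarith) (by linarith) hU hV ?_ (pos_iff_ne_zero.2 hc0)
      ?_).trans (dimH_mono (subset_univ _))
    · intro h01
      have := injective_toGraph _ (g.injective h01)
      rw [projIcc_left, projIcc_right] at this
      simpa using congrArg Subtype.val this
    · rw [lt_div_iff₀ (by linarith)]
      nlinarith [c.coe_nonneg]

end ZigzagGraph

theorem corollary1p4 (d : ℝ) (hd : d ∈ Set.Icc (1 : ℝ) 2) :
    ∃ f : Set.Icc (0 : ℝ) 1 → ℝ, Continuous f ∧
      IsMinimalForConformalDim (euclideanGraph f) ∧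
      conformalDim (euclideanGraph f) = ENNReal.ofReal d := by
  rcases hd.1.eq_or_lt with rfl | h
  · simpa using ZigzagGraph.exists_minimal_graph_one
  · exact ZigzagGraph.exists_minimal_graph h hd.2
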